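/- **Setting.** Let $X_0(x)=\sum_{k\ge 0}a_kx^{2k}$ with $a_0=5/2$ and $2(k+1)(4k^2+5/4)\,a_{k+1}+(2k-1)\,a_k=0$ $(k\ge 0)$, so that $X_0=5/2+x^2-x^4/21+\cdots$ (the series converges on $\mathbb R$), and let $$h(x,y)=2X_0-xX_0'+y^2X_0'/x+\sqrt5,\qquad D=\{(x,y)\in\mathbb R^2\mid x>0\}.$$ Put $$a_1=\tfrac{2y}{xh}\big(X_0+\tfrac{\sqrt5}{2}\big),\quad b_1=\tfrac{-1}{xh}\big(X_0+\tfrac{\sqrt5}{2}+\sqrt5(x^2-y^2)\big),\quad c_1=\tfrac{-2}{xh}\big(X_0+\tfrac{\sqrt5}{2}\big),$$ $$a_2=\tfrac{-1}{h}\big(2X_0+\sqrt5-(x^2+y^2)\tfrac{X_0'}{x}\big),\quad b_2=\tfrac{-2y}{h}\big(\tfrac{X_0'}{2x}+\sqrt5\big),\quad c_2=\tfrac{2y}{h}\big(X_0''-\tfrac{X_0'}{x}\big).$$ Let $F^0=[\phi,X^0_\alpha,X^0_\beta,\xi]$ be an orthonormal frame field of $\mathbb R^4$ on $D$ satisfying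 the structure equation $$\phi_x=-a_1X^0_\alpha,\quad (X^0_\alpha)_x=a_1\phi-b_1\xi-c_1X^0_\beta,\quad (X^0_\beta)_x=c_1X^0_\alpha,\quad \xi_x=b_1X^0_\alpha,$$ $$\phi_y=-a_2X^0_\beta,\quad (X^0_\alpha)_y=c_2X^0_\beta,\quad (X^0_\beta)_y=a_2\phi-b_2\xi-c_2X^0_\alpha,\quad \xi_y=b_2X^0_\beta,$$ and let $f^0:D\to\mathbb R^4$ be a curvature surface determined by $F^0$, i.e. $df^0=\frac{x^2-y^2}{xh}\,dx\,X^0_\alpha+\frac{2y}{h}\,dy\,X^0_\beta$. Put $B_2(x)=-\frac12\frac{X_0'}{x}-\sqrt5$, $C_2(x)=X_0''-\frac{X_0'}{x}$, $$T(x)=\frac{(X_0'+2\sqrt5\,x)(2X_0+\sqrt5)}{4xX_0'\,(2X_0-xX_0'-X_0'/x+\sqrt5)},\qquad \tilde w(x)=\frac{\sqrt5}{2}\log x+\int_0^x\Big[T(s)-\frac{\sqrt5}{2s}\Big]ds .$$ **Theorem.** The integral defining $\tilde w(x)$ exists for every $x>0$. There are functions $\boldsymbol u(y)$ $(y\in\mathbb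 R)$ and $\tilde{\boldsymbol u}(x)$, $\tilde A(x)$ $(x>0)$ with values in $\mathbb R^4$ such that for all $(x,y)\in D$ $$\boldsymbol u(y)=(1+y^2)^{-1/2}(yX^0_\beta-\phi)(x,y),\qquad \tilde{\boldsymbol u}(x)=(B_2^2+C_2^2)^{-1/2}(x)\,(-B_2X^0_\alpha+C_2\xi)(x,y),$$ $$f^0(x,y)=(B_2^2+C_2^2)^{-1/2}(x)\,\tilde{\boldsymbol f}(x,y)+\tilde A(x),\qquad \tilde{\boldsymbol f}=(B_2^2+C_2^2)^{-1/2}(C_2X^0_\alpha+B_2\xi),$$ and there is an orthonormal basis $[\boldsymbol b^\infty,\boldsymbol c^\infty,\tilde{\boldsymbol b}^\infty,\tilde{\boldsymbol c}^\infty]$ of $\mathbb R^4$, determined by the properties that, as $s\to\infty$, $$X^0_\alpha(e^{-s},y)-\Big(\cos\tfrac{\sqrt5 s}{2}\,\boldsymbol b^\infty-\sin\tfrac{\sqrt5 s}{2}\,\boldsymbol c^\infty\Big)\to 0\quad\text{uniformly in }y\in\mathbb R,$$ and $\boldsymbol u(y)=-\sin(y-\arctan y)\,\tilde{\boldsymbol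 b}^\infty+\cos(y-\arctan y)\,\tilde{\boldsymbol c}^\infty$ for all $y\in\mathbb R$, such that: 1. There is a unit vector $\tilde{\boldsymbol v}_1(x)$ $(x>0)$ with $\frac{d\tilde{\boldsymbol u}}{dx}=T\,\tilde{\boldsymbol v}_1$ and $\frac{d\tilde{\boldsymbol v}_1}{dx}=-T\,\tilde{\boldsymbol u}$ on $(0,\infty)$. Furthermore $$\tilde{\boldsymbol u}(x)=\cos\tilde w(x)\,\boldsymbol b^\infty+\sin\tilde w(x)\,\boldsymbol c^\infty,\qquad \tilde{\boldsymbol v}_1(x)=-\sin\tilde w(x)\,\boldsymbol b^\infty+\cos\tilde w(x)\,\boldsymbol c^\infty .$$ 2. As $y\to\infty$, $f^0(x,y)$ converges to the point $(B_2^2+C_2^2)^{-1/2}(x)\,\tilde{\boldsymbol v}_1(x)+\tilde A(x)$. 3. As $y\to\infty$, $X^0_\beta(x,y)-\big(\cos y\,\tilde{\boldsymbol b}^\infty+\sin y\,\tilde{\boldsymbol c}^\infty\big)\to 0$ and $\phi(x,y)-\big(-\sin y\,\tilde{\boldsymbol b}^\infty+\cos y\,\tilde{\boldsymbol c}^\infty\big)\to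 0$. The convergences in 2 and 3 are locally uniform in $x\in(0,\infty)$. -/

import Mathlib

open Real Set Filter Topology

namespace CurvatureSurface

/-- The Euclidean space `ℝ⁴`. -/
abbrev E4 : Type := EuclideanSpace ℝ (Fin 4)

/-- Coefficients of the power series `X₀(x) = ∑ aₖ x²ᵏ`: `a₀ = 5/2` and
`2 (k+1) (4k² + 5/4) aₖ₊₁ + (2k - 1) aₖ = 0` (so `a₁ = 1`). -/
noncomputable def coeff : ℕ → ℝ
  | 0 => 5 / 2
  | k + 1 => -((2 * (k : ℝ) - 1) / (2 * ((k : ℝ) + 1) * (4 * (k : ℝ) ^ 2 + 5 / 4))) * coeff k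

/-- The generalized hypergeometric function `X₀(x) = 5/2 + x² - x⁴/21 + ⋯`. -/
noncomputable def X₀ (x : ℝ) : ℝ := ∑' k : ℕ, coeff k * x ^ (2 * k)

/-- `X₀'`. -/
noncomputable def dX₀ : ℝ → ℝ := deriv X₀

/-- `X₀''`. -/
noncomputable def ddX₀ : ℝ → ℝ := deriv dX₀

theorem coeff_one : coeff 1 = 1 := by
  norm_num [coeff]

theorem coeff_two : coeff 2 = -(1 / 21) := by
  norm_num [coeff]

theorem coeff_rec (k : ℕ) :
    2 * ((k : ℝ) + 1) * (4 * (k : ℝ) ^ 2 + 5 / 4) * coeff (k + 1)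
      + (2 * (k : ℝ) - 1) * coeff k = 0 := by
  have h1 : ((k : ℝ) + 1) ≠ 0 := by positivity
  have h2 : (4 * (k : ℝ) ^ 2 + 5 / 4) ≠ 0 := by positivity
  rw [coeff]
  field_simp
  ring

/-- The series defining `X₀` converges on the whole line. -/
theorem summable_X₀ (x : ℝ) : Summable fun k : ℕ => coeff k * x ^ (2 * k) := by
  have key : ∀ k : ℕ, |coeff k| ≤ 5 / 2 * (1 / (k.factorial : ℝ)) := by
    intro k
    induction k with
    | zero => norm_num [coeff]
    | succ k ih =>
      have hk : (0 : ℝ) ≤ k := Nat.cast_nonneg k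
      rw [coeff, abs_mul, abs_neg, abs_div, Nat.factorial_succ]
      have hpos : (0 : ℝ) < 2 * ((k : ℝ) + 1) * (4 * (k : ℝ) ^ 2 + 5 / 4) := by positivity
      rw [abs_of_pos hpos]
      have hr : |2 * (k : ℝ) - 1| / (2 * ((k : ℝ) + 1) * (4 * (k : ℝ) ^ 2 + 5 / 4))
          ≤ 1 / ((k : ℝ) + 1) := by
        rw [div_le_div_iff₀ hpos (by positivity)]
        have : |2 * (k : ℝ) - 1| ≤ 2 * (4 * (k : ℝ) ^ 2 + 5 / 4) := by
          rw [abs_le]; constructor <;> nlinarith [sq_nonneg ((k : ℝ) - 1)]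
        nlinarith
      calc _ ≤ 1 / ((k : ℝ) + 1) * (5 / 2 * (1 / (k.factorial : ℝ))) := by gcongr
        _ = _ := by push_cast; field_simp
  refine Summable.of_norm_bounded (g := fun k : ℕ => 5 / 2 * ((x ^ 2) ^ k / (k.factorial : ℝ)))
    ((Real.summable_pow_div_factorial (x ^ 2)).mul_left _) ?_
  intro k
  rw [Real.norm_eq_abs, abs_mul, pow_mul, abs_of_nonneg (a := (x ^ 2) ^ k) (by positivity)]
  calc _ ≤ 5 / 2 * (1 / (k.factorial : ℝ)) * (x ^ 2) ^ k := by gcongr; exact key k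
    _ = _ := by ring

/-- `h(x,y) = 2 X₀ - x X₀' + y² X₀'/x + √5`. -/
noncomputable def h (x y : ℝ) : ℝ := 2 * X₀ x - x * dX₀ x + y ^ 2 * (dX₀ x / x) + √5

/-! The coefficients of the structure equation of the frame field. -/

noncomputable def a₁ (x y : ℝ) : ℝ := 2 * y / (x * h x y) * (X₀ x + √5 / 2)

noncomputable def b₁ (x y : ℝ) : ℝ :=
  -1 / (x * h x y) * (X₀ x + √5 / 2 + √5 * (x ^ 2 - y ^ 2))

noncomputable def c₁ (x y : ℝ) : ℝ := -2 / (x * h x y) * (X₀ x + √5 / 2)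

noncomputable def a₂ (x y : ℝ) : ℝ :=
  -1 / h x y * (2 * X₀ x + √5 - (x ^ 2 + y ^ 2) * (dX₀ x / x))

noncomputable def b₂ (x y : ℝ) : ℝ := -2 * y / h x y * (dX₀ x / (2 * x) + √5)

noncomputable def c₂ (x y : ℝ) : ℝ := 2 * y / h x y * (ddX₀ x - dX₀ x / x)

/-- `[φ, X_α, X_β, ξ]` is an orthonormal frame field of `ℝ⁴` on `D = {(x,y) | x > 0}` which solves
the structure equation `dF = F Ω`, `Ω = Ω₁ dx + Ω₂ dy`, written out column by column.
(Joint analyticity on `D` follows from these equations and is not assumed separately.) -/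
structure IsFrameField (φ Xα Xβ ξ : ℝ → ℝ → E4) : Prop where
  orthonormal : ∀ x y, 0 < x → Orthonormal ℝ ![φ x y, Xα x y, Xβ x y, ξ x y]
  dx_φ : ∀ x y, 0 < x → HasDerivAt (fun s => φ s y) (-(a₁ x y • Xα x y)) x
  dx_Xα : ∀ x y, 0 < x →
    HasDerivAt (fun s => Xα s y) (a₁ x y • φ x y - b₁ x y • ξ x y - c₁ x y • Xβ x y) x
  dx_Xβ : ∀ x y, 0 < x → HasDerivAt (fun s => Xβ s y) (c₁ x y • Xα x y) x
  dx_ξ : ∀ x y, 0 < x → HasDerivAt (fun s => ξ s y) (b₁ x y • Xα x y) x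
  dy_φ : ∀ x y, 0 < x → HasDerivAt (fun t => φ x t) (-(a₂ x y • Xβ x y)) y
  dy_Xα : ∀ x y, 0 < x → HasDerivAt (fun t => Xα x t) (c₂ x y • Xβ x y) y
  dy_Xβ : ∀ x y, 0 < x →
    HasDerivAt (fun t => Xβ x t) (a₂ x y • φ x y - b₂ x y • ξ x y - c₂ x y • Xα x y) y
  dy_ξ : ∀ x y, 0 < x → HasDerivAt (fun t => ξ x t) (b₂ x y • Xβ x y) y

/-- `f` is a curvature surface on `D` determined by the frame field `[φ, X_α, X_β, ξ]`:
`df = ((x² - y²) / (x h)) dx X_α + (2 y / h) dy X_β`. -/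
structure IsCurvatureSurface (f φ Xα Xβ ξ : ℝ → ℝ → E4) : Prop where
  frame : IsFrameField φ Xα Xβ ξ
  dx : ∀ x y, 0 < x →
    HasDerivAt (fun s => f s y) (((x ^ 2 - y ^ 2) / (x * h x y)) • Xα x y) x
  dy : ∀ x y, 0 < x → HasDerivAt (fun t => f x t) ((2 * y / h x y) • Xβ x y) y

/-- `B₂(x) = -(1/2) X₀'/x - √5`. -/
noncomputable def B₂ (x : ℝ) : ℝ := -(1 / 2) * (dX₀ x / x) - √5

/-- `C₂(x) = X₀'' - X₀'/x`. -/
noncomputable def C₂ (x : ℝ) : ℝ := ddX₀ x - dX₀ x / x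

/-- `(B₂² + C₂²)^{1/2}`. -/
noncomputable def ρ (x : ℝ) : ℝ := √(B₂ x ^ 2 + C₂ x ^ 2)

/-- The speed `T(x)`. -/
noncomputable def T (x : ℝ) : ℝ :=
  (dX₀ x + 2 * √5 * x) * (2 * X₀ x + √5) /
    (4 * x * dX₀ x * (2 * X₀ x - x * dX₀ x - dX₀ x / x + √5))

/-- The regularized integral `w̃` of `T`. -/
noncomputable def wTilde (x : ℝ) : ℝ :=
  √5 / 2 * Real.log x + ∫ s in (0 : ℝ)..x, (T s - √5 / 2 * (1 / s))

/-- `u(y) = (1 + y²)^{-1/2} (y X_β - φ)(x, y)` for every `x > 0`. -/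
def IsU (φ Xβ : ℝ → ℝ → E4) (u : ℝ → E4) : Prop :=
  ∀ x y, 0 < x → u y = (√(1 + y ^ 2))⁻¹ • (y • Xβ x y - φ x y)

/-- `ũ(x) = (B₂² + C₂²)^{-1/2} (-B₂ X_α + C₂ ξ)(x, y)` for every `y`. -/
def IsUTilde (Xα ξ : ℝ → ℝ → E4) (uT : ℝ → E4) : Prop :=
  ∀ x y, 0 < x → uT x = (ρ x)⁻¹ • (-(B₂ x • Xα x y) + C₂ x • ξ x y)

/-- The unit vector `f̃ = (B₂² + C₂²)^{-1/2} (C₂ X_α + B₂ ξ)`. -/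
noncomputable def fTilde (Xα ξ : ℝ → ℝ → E4) (x y : ℝ) : E4 :=
  (ρ x)⁻¹ • (C₂ x • Xα x y + B₂ x • ξ x y)

/-- `Ã(x)`, the centre of the sphere containing the `y`-curve at `x`:
`f(x, y) = (B₂² + C₂²)^{-1/2} f̃(x, y) + Ã(x)` for every `y`. -/
def IsATilde (f Xα ξ : ℝ → ℝ → E4) (A : ℝ → E4) : Prop :=
  ∀ x y, 0 < x → f x y = (ρ x)⁻¹ • fTilde Xα ξ x y + A x

/-- `[b, c, b̃, c̃]` is the orthonormal basis `[b^∞, c^∞, b̃^∞, c̃^∞]` of `ℝ⁴` belonging to the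
surface: `X_α(e^{-s}, y)` approaches the circle `cos (√5 s / 2) b - sin (√5 s / 2) c` as `s → ∞`,
uniformly in `y`, and `u(y) = -sin (y - arctan y) b̃ + cos (y - arctan y) c̃`.
These conditions determine the four vectors uniquely. -/
structure IsLimitFrame (Xα : ℝ → ℝ → E4) (u : ℝ → E4) (b c bT cT : E4) : Prop where
  orthonormal : Orthonormal ℝ ![b, c, bT, cT]
  limit_Xα : ∀ ε > 0, ∃ S : ℝ, ∀ s > S, ∀ y : ℝ,
    ‖Xα (Real.exp (-s)) y - (Real.cos (√5 * s / 2) • b - Real.sin (√5 * s / 2) • c)‖ < ε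
  u_eq : ∀ y, u y =
    -(Real.sin (y - Real.arctan y) • bT) + Real.cos (y - Real.arctan y) • cT

end CurvatureSurface

open Real Set Filter Topology

namespace CurvatureSurface

/-! Everything is expressed through `P` = X₀'/x, `C` = xP' (which is C₂) and `G`. The recursion for
the coefficients is a third-order equation for X₀, which makes a quadratic expression in P, C and X₀
constant (`first_integral`). That identity says B₂² + C₂² = PG (`P_mul_G`). It forces P > 0 and G >
0, hence h = G + (1 + y²)P > 0, and no denominator vanishes on D.

Rotating the pairs (X_β, φ) and (ξ, X_α) gives the orthonormal frame ũ, f̃, u, e. The structure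
equation shows that u does not depend on x, nor ũ on y. A further orthogonal change of f̃, e gives v
and w with ũ' = Tv, v' = -Tũ in x and u' = -kw, w' = ku in y, where k = y²/(1 + y²). So ũ and u run
on great circles in orthogonal planes, with angles w̃(x) and y - arctan y; undoing these rotations
leaves four constant vectors, the required basis.

As y → ∞ the change of frame degenerates: f̃ - v and e + w are O(1/y), locally uniformly in x
(`four_G_div_h_le`). This gives the limits of f, X_β and φ. As x → 0, ρ → 1 + √5, B₂ → -ρ and C₂ →
0, so ũ merges with X_α, while w̃ merges with (√5/2) log x because xT(x) → √5/2; this is the limit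
circle of X_α. -/

/-! ### Power series with factorially decaying coefficients. -/

/-- The sum of the power series with coefficients `c`. -/
noncomputable def powSum (c : ℕ → ℝ) (t : ℝ) : ℝ := ∑' k : ℕ, c k * t ^ k

/-- The coefficients of the derivative of a power series. -/
noncomputable def derivCoeff (c : ℕ → ℝ) (k : ℕ) : ℝ := ((k : ℝ) + 1) * c (k + 1)

/-- Since (k+1)/(k+1)! = 1/k!, the constant M survives differentiation, so one estimate on `coeff`
serves all derivatives. -/
theorem derivCoeff_bound {c : ℕ → ℝ} {M : ℝ} (hc : ∀ k, |c k| ≤ M / (k.factorial : ℝ)) (k : ℕ) :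
    |derivCoeff c k| ≤ M / (k.factorial : ℝ) := by
  have hk : (0 : ℝ) < (k : ℝ) + 1 := by positivity
  rw [derivCoeff, abs_mul, abs_of_pos hk]
  calc ((k : ℝ) + 1) * |c (k + 1)| ≤ ((k : ℝ) + 1) * (M / ((k + 1).factorial : ℝ)) := by
        gcongr; exact hc _
    _ = M / (k.factorial : ℝ) := by
        rw [Nat.factorial_succ]; push_cast; field_simp

theorem summable_pow_of_bound {c : ℕ → ℝ} {M : ℝ} (hc : ∀ k, |c k| ≤ M / (k.factorial : ℝ))
    (t : ℝ) : Summable fun k : ℕ => c k * t ^ k := by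
  refine Summable.of_norm_bounded (g := fun k : ℕ => M * (|t| ^ k / (k.factorial : ℝ)))
    ((Real.summable_pow_div_factorial |t|).mul_left _) fun k => ?_
  rw [Real.norm_eq_abs, abs_mul, abs_pow]
  calc _ ≤ M / (k.factorial : ℝ) * |t| ^ k := by gcongr; exact hc k
    _ = _ := by ring

theorem hasSum_powSum {c : ℕ → ℝ} {M : ℝ} (hc : ∀ k, |c k| ≤ M / (k.factorial : ℝ))
    (t : ℝ) : HasSum (fun k : ℕ => c k * t ^ k) (powSum c t) :=
  (summable_pow_of_bound hc t).hasSum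

theorem hasSum_mul_of_hasSum_shift {d : ℕ → ℝ} (hd : d 0 = 0) {t s : ℝ}
    (hs : HasSum (fun k : ℕ => d (k + 1) * t ^ k) s) :
    HasSum (fun k : ℕ => d k * t ^ k) (t * s) := by
  rw [← hasSum_nat_add_iff' 1]
  simp only [Finset.range_one, Finset.sum_singleton, hd, zero_mul, sub_zero]
  have hfun : (fun k : ℕ => d (k + 1) * t ^ (k + 1)) = fun k => t * (d (k + 1) * t ^ k) := by
    funext k; ring
  rw [hfun]
  exact hs.mul_left t

theorem hasDerivAt_powSum {c : ℕ → ℝ} {M : ℝ} (hc : ∀ k, |c k| ≤ M / (k.factorial : ℝ))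
    (t : ℝ) : HasDerivAt (powSum c) (powSum (derivCoeff c) t) t := by
  set R := |t| + 1
  have hmem : t ∈ Metric.ball (0 : ℝ) R := by simp [R]
  have hsum : Summable fun k : ℕ => |derivCoeff c k| * R ^ k := by
    have := (summable_pow_of_bound (t := R) (derivCoeff_bound hc)).abs
    simpa [abs_mul, abs_of_nonneg (show 0 ≤ R by positivity)] using this
  -- The exponent k - 1 is truncated at k = 0, where the factor k kills the term.
  have hsum' : Summable fun k : ℕ => |(k : ℝ) * c k| * R ^ (k - 1) := by
    rw [← summable_nat_add_iff 1]
    simpa [derivCoeff] using hsum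
  have key := hasDerivAt_tsum_of_isPreconnected (g := fun (k : ℕ) (s : ℝ) => c k * s ^ k)
    (g' := fun k s => c k * ((k : ℝ) * s ^ (k - 1))) hsum' Metric.isOpen_ball
    (convex_ball (0 : ℝ) R).isPreconnected
    (fun k s _ => (hasDerivAt_pow k s).const_mul _)
    (fun k s hs => ?_) hmem (summable_pow_of_bound hc t) hmem
  · refine HasDerivAt.congr_deriv (f := powSum c) key ?_
    have hs : Summable fun k : ℕ => c k * ((k : ℝ) * t ^ (k - 1)) := by
      rw [← summable_nat_add_iff 1]
      refine (summable_pow_of_bound (derivCoeff_bound hc) t).congr fun k => ?_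
      simp only [derivCoeff, Nat.cast_add, Nat.cast_one, Nat.add_sub_cancel]
      ring
    rw [hs.tsum_eq_zero_add, powSum]
    simp only [derivCoeff, Nat.cast_zero, zero_mul, mul_zero, zero_add, Nat.cast_add,
      Nat.cast_one, Nat.add_sub_cancel]
    exact tsum_congr fun k => by ring
  · have hs' : |s| ≤ R := by simpa using (mem_ball_zero_iff.mp hs).le
    rw [Real.norm_eq_abs, show c k * ((k : ℝ) * s ^ (k - 1)) = ((k : ℝ) * c k) * s ^ (k - 1) by ring,
      abs_mul _ (s ^ (k - 1)), abs_pow]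
    gcongr

theorem coeff_bound (k : ℕ) : |coeff k| ≤ 5 / 2 / (k.factorial : ℝ) := by
  induction k with
  | zero => norm_num [coeff]
  | succ k ih =>
    rw [coeff, abs_mul, abs_neg, abs_div, Nat.factorial_succ]
    have hpos : (0 : ℝ) < 2 * ((k : ℝ) + 1) * (4 * (k : ℝ) ^ 2 + 5 / 4) := by positivity
    rw [abs_of_pos hpos]
    have hr : |2 * (k : ℝ) - 1| / (2 * ((k : ℝ) + 1) * (4 * (k : ℝ) ^ 2 + 5 / 4))
        ≤ 1 / ((k : ℝ) + 1) := by
      rw [div_le_div_iff₀ hpos (by positivity)]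
      have : |2 * (k : ℝ) - 1| ≤ 2 * (4 * (k : ℝ) ^ 2 + 5 / 4) := by
        rw [abs_le]; constructor <;> nlinarith [sq_nonneg ((k : ℝ) - 1)]
      nlinarith
    calc _ ≤ 1 / ((k : ℝ) + 1) * (5 / 2 / (k.factorial : ℝ)) := by gcongr
      _ = _ := by push_cast; field_simp

/-! ### The differential equation of X₀, its first integral, and positivity. -/

/-- The even entire function which equals `X₀'/x` away from `0`. -/
noncomputable def P (x : ℝ) : ℝ := 2 * powSum (derivCoeff coeff) (x ^ 2)

/-- The even entire function `x P'`, which equals `C₂` away from `0`. -/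
noncomputable def C (x : ℝ) : ℝ := 4 * x ^ 2 * powSum (derivCoeff (derivCoeff coeff)) (x ^ 2)

theorem hasDerivAt_powSum_sq {c : ℕ → ℝ} {M : ℝ} (hc : ∀ k, |c k| ≤ M / (k.factorial : ℝ))
    (x : ℝ) : HasDerivAt (fun s => powSum c (s ^ 2)) (powSum (derivCoeff c) (x ^ 2) * (2 * x)) x := by
  have := (hasDerivAt_powSum hc (x ^ 2)).comp x (hasDerivAt_pow 2 x)
  exact this.congr_deriv (by simp)

theorem X₀_eq_powSum : X₀ = fun x => powSum coeff (x ^ 2) := by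
  funext x
  simp only [X₀, powSum, pow_mul]

theorem hasDerivAt_X₀ (x : ℝ) : HasDerivAt X₀ (x * P x) x := by
  rw [X₀_eq_powSum]
  refine (hasDerivAt_powSum_sq coeff_bound x).congr_deriv ?_
  simp only [P]; ring

theorem dX₀_eq (x : ℝ) : dX₀ x = x * P x := (hasDerivAt_X₀ x).deriv

/-- The formula also holds at x = 0: P is even, so its derivative there is 0, which is also the
value of a quotient by 0. The same applies to `hasDerivAt_C`. -/
theorem hasDerivAt_P (x : ℝ) : HasDerivAt P (C x / x) x := by
  refine ((hasDerivAt_powSum_sq (derivCoeff_bound coeff_bound) x).const_mul 2).congr_deriv ?_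
  rcases eq_or_ne x 0 with rfl | hx
  · simp
  · simp only [C]; field_simp; ring

theorem differentiable_P : Differentiable ℝ P := fun x =>
  ((hasDerivAt_powSum_sq (derivCoeff_bound coeff_bound) x).const_mul 2).differentiableAt

theorem ddX₀_eq {x : ℝ} (hx : x ≠ 0) : ddX₀ x = P x + C x := by
  have hd : dX₀ = fun x => x * P x := funext dX₀_eq
  rw [ddX₀, hd]
  refine ((hasDerivAt_id x).mul (hasDerivAt_P x)).deriv.trans ?_
  simp only [id]; field_simp

theorem dX₀_div {x : ℝ} (hx : x ≠ 0) : dX₀ x / x = P x := by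
  rw [dX₀_eq]; field_simp

theorem C₂_eq {x : ℝ} (hx : x ≠ 0) : C₂ x = C x := by
  rw [C₂, ddX₀_eq hx, dX₀_div hx]; ring

/-- Comparing coefficients of tᵏ, with t = x², turns this equation into `coeff_rec`: the two terms
on the left contribute 8k + 8k(k-1) = 8k². -/
theorem powSum_ode (t : ℝ) :
    8 * (t * powSum (derivCoeff (derivCoeff coeff)) t)
      + 8 * (t * (t * powSum (derivCoeff (derivCoeff (derivCoeff coeff))) t))
      = powSum coeff t - 2 * (t * powSum (derivCoeff coeff) t)
        - 5 / 2 * powSum (derivCoeff coeff) t := by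
  have b0 := coeff_bound
  have b1 := derivCoeff_bound b0
  have b2 := derivCoeff_bound b1
  have b3 := derivCoeff_bound b2
  have s0 := hasSum_powSum b0 t
  have s1 := hasSum_powSum b1 t
  have t1 : HasSum (fun k : ℕ => ((k : ℝ) * coeff k) * t ^ k) (t * powSum (derivCoeff coeff) t) :=
    hasSum_mul_of_hasSum_shift (d := fun k => (k : ℝ) * coeff k) (by simp)
      (by simpa [derivCoeff] using s1)
  have t2 : HasSum (fun k : ℕ => ((k : ℝ) * derivCoeff coeff k) * t ^ k)
      (t * powSum (derivCoeff (derivCoeff coeff)) t) :=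
    hasSum_mul_of_hasSum_shift (d := fun k => (k : ℝ) * derivCoeff coeff k) (by simp)
      (by simpa [derivCoeff] using hasSum_powSum b2 t)
  have t3 : HasSum (fun k : ℕ => ((k : ℝ) * derivCoeff (derivCoeff coeff) k) * t ^ k)
      (t * powSum (derivCoeff (derivCoeff (derivCoeff coeff))) t) :=
    hasSum_mul_of_hasSum_shift (d := fun k => (k : ℝ) * derivCoeff (derivCoeff coeff) k) (by simp)
      (by simpa [derivCoeff] using hasSum_powSum b3 t)
  have t4 : HasSum (fun k : ℕ => (((k : ℝ) - 1) * k * derivCoeff coeff k) * t ^ k)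
      (t * (t * powSum (derivCoeff (derivCoeff (derivCoeff coeff))) t)) := by
    refine hasSum_mul_of_hasSum_shift
      (d := fun k => ((k : ℝ) - 1) * k * derivCoeff coeff k) (by simp) ?_
    convert t3 using 1
    funext k
    simp only [derivCoeff]; push_cast; ring
  refine HasSum.unique ((t2.mul_left 8).add (t4.mul_left 8)) ?_
  have hr := (s0.sub (t1.mul_left 2)).sub (s1.mul_left (5 / 2))
  have hfun : (fun k : ℕ => 8 * ((k : ℝ) * derivCoeff coeff k * t ^ k)
      + 8 * (((k : ℝ) - 1) * k * derivCoeff coeff k * t ^ k))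
      = fun k : ℕ => coeff k * t ^ k - 2 * ((k : ℝ) * coeff k * t ^ k)
        - 5 / 2 * (derivCoeff coeff k * t ^ k) := by
    funext k
    simp only [derivCoeff]
    linear_combination (t ^ k) * coeff_rec k
  rw [hfun]
  exact hr

theorem hasDerivAt_C (x : ℝ) :
    HasDerivAt C ((X₀ x - x ^ 2 * P x - 5 / 4 * P x) / x) x := by
  have := ((hasDerivAt_pow 2 x).const_mul 4).mul
    (hasDerivAt_powSum_sq (derivCoeff_bound (derivCoeff_bound coeff_bound)) x)
  refine this.congr_deriv ?_
  rcases eq_or_ne x 0 with rfl | hx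
  · simp
  have ode := powSum_ode (x ^ 2)
  rw [X₀_eq_powSum]
  simp only [P]
  field_simp
  push_cast
  linear_combination 4 * ode

theorem differentiable_C : Differentiable ℝ C := fun x =>
  (((hasDerivAt_pow 2 x).const_mul 4).mul
    (hasDerivAt_powSum_sq (derivCoeff_bound (derivCoeff_bound coeff_bound)) x)).differentiableAt

theorem powSum_zero (c : ℕ → ℝ) : powSum c 0 = c 0 := by
  rw [powSum, tsum_eq_single 0] <;> simp +contextual

theorem P_zero : P 0 = 2 := by
  simp [P, powSum_zero, derivCoeff, coeff_one]

theorem C_zero : C 0 = 0 := by simp [C]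

theorem X₀_zero : X₀ 0 = 5 / 2 := by
  simp [X₀_eq_powSum, powSum_zero, coeff]

/-- With xP' = C and xC' = X₀ - x²P - (5/4)P the derivative cancels identically; the constant is the
value at 0, namely 5 - 10. -/
theorem first_integral (x : ℝ) :
    C x ^ 2 + 5 / 4 * P x ^ 2 + x ^ 2 * P x ^ 2 - 2 * P x * X₀ x = -5 := by
  set F : ℝ → ℝ := fun x => C x ^ 2 + 5 / 4 * P x ^ 2 + x ^ 2 * P x ^ 2 - 2 * P x * X₀ x with hFd
  have hF : ∀ s, HasDerivAt F 0 s := fun s => by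
    have hC := hasDerivAt_C s
    have hP := hasDerivAt_P s
    have hX := hasDerivAt_X₀ s
    refine ((((hC.pow 2).add ((hP.pow 2).const_mul (5 / 4))).add
      ((hasDerivAt_pow 2 s).mul (hP.pow 2))).sub ((hP.const_mul 2).mul hX)).congr_deriv ?_
    rcases eq_or_ne s 0 with rfl | hs
    · simp
    · simp only [Pi.pow_apply]; field_simp; push_cast; ring
  have := is_const_of_deriv_eq_zero (fun s => (hF s).differentiableAt) (fun s => (hF s).deriv) x 0
  change F x = -5
  rw [this]
  norm_num [hFd, C_zero, P_zero, X₀_zero]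

/-- At a zero of P the first integral would read C² = -5. So P keeps the sign of P(0) = 2. -/
theorem P_pos (x : ℝ) : 0 < P x := by
  have hne : ∀ s, P s ≠ 0 := fun s hs => by
    have := first_integral s
    rw [hs] at this
    nlinarith [sq_nonneg (C s)]
  by_contra! hle
  have hmem : (0 : ℝ) ∈ P '' univ :=
    (isPreconnected_univ.image P differentiable_P.continuous.continuousOn).ordConnected.out
      ⟨x, trivial, rfl⟩ ⟨0, trivial, rfl⟩ ⟨hle, by rw [P_zero]; norm_num⟩
  obtain ⟨s, -, hs⟩ := hmem
  exact hne s hs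

/-- The factor `2 X₀ - x X₀' - X₀'/x + √5`. -/
noncomputable def G (x : ℝ) : ℝ := 2 * X₀ x - x ^ 2 * P x - P x + √5

theorem B₂_eq {x : ℝ} (hx : x ≠ 0) : B₂ x = -(1 / 2) * P x - √5 := by
  rw [B₂, dX₀_div hx]

/-- The first integral rewritten as ρ² = PG; the √5 in `G` supplies the cross term of B₂². -/
theorem P_mul_G (x : ℝ) : P x * G x = (-(1 / 2) * P x - √5) ^ 2 + C x ^ 2 := by
  have h5 : √5 ^ 2 = 5 := Real.sq_sqrt (by norm_num)
  rw [G]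
  linear_combination (-1) * first_integral x - h5

theorem G_pos (x : ℝ) : 0 < G x := by
  have h1 := P_mul_G x
  have h2 := P_pos x
  have h5 : 0 < √5 := by positivity
  have : 0 < P x * G x := by rw [h1]; nlinarith [sq_nonneg (C x)]
  exact pos_of_mul_pos_right this h2.le

theorem hasDerivAt_G (x : ℝ) : HasDerivAt G (-(x ^ 2 + 1) * (C x / x)) x := by
  have hP := hasDerivAt_P x
  refine (((((hasDerivAt_X₀ x).const_mul 2).sub ((hasDerivAt_pow 2 x).mul hP)).sub
    hP).add_const (√5)).congr_deriv ?_
  push_cast; ring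

theorem h_eq {x : ℝ} (hx : x ≠ 0) (y : ℝ) : h x y = G x + (1 + y ^ 2) * P x := by
  rw [h, dX₀_div hx, dX₀_eq, G]; ring

theorem h_pos {x : ℝ} (hx : x ≠ 0) (y : ℝ) : 0 < h x y := by
  rw [h_eq hx]
  have := P_pos x
  have := G_pos x
  positivity

theorem ρ_eq {x : ℝ} (hx : x ≠ 0) : ρ x = √(P x * G x) := by
  rw [ρ, B₂_eq hx, C₂_eq hx, P_mul_G]

theorem ρ_pos {x : ℝ} (hx : x ≠ 0) : 0 < ρ x := by
  rw [ρ_eq hx]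
  exact Real.sqrt_pos.mpr (mul_pos (P_pos x) (G_pos x))

theorem ρ_sq {x : ℝ} (hx : x ≠ 0) : ρ x ^ 2 = P x * G x := by
  rw [ρ_eq hx]
  exact Real.sq_sqrt (mul_pos (P_pos x) (G_pos x)).le

theorem X₀_add_eq (x : ℝ) : X₀ x + √5 / 2 = (G x + x ^ 2 * P x + P x) / 2 := by
  rw [G]; ring

/-! ### The speed T and its regularized primitive. -/

/-- `x T(x)`, as a function which is regular at `0`. -/
noncomputable def xT (x : ℝ) : ℝ :=
  (P x + 2 * √5) * (G x + x ^ 2 * P x + P x) / (4 * P x * G x)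

theorem T_eq {x : ℝ} (hx : x ≠ 0) : T x = xT x / x := by
  have hP := (P_pos x).ne'
  have hG := (G_pos x).ne'
  have hG' : 2 * X₀ x - x * dX₀ x - dX₀ x / x + √5 = G x := by
    rw [dX₀_div hx, dX₀_eq, G]; ring
  have hX : 2 * X₀ x + √5 = G x + x ^ 2 * P x + P x := by rw [G]; ring
  rw [T, hG', hX, dX₀_eq, xT]
  field_simp

theorem xT_pos (x : ℝ) : 0 < xT x := by
  have := P_pos x
  have := G_pos x
  rw [xT]; positivity

theorem T_pos {x : ℝ} (hx : 0 < x) : 0 < T x := by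
  rw [T_eq hx.ne']
  exact div_pos (xT_pos x) hx

/-- The coefficient of the pole of T at 0, which is why `wTilde` subtracts √5/(2s) and adds back the
logarithm. -/
theorem xT_zero : xT 0 = √5 / 2 := by
  have h5 : √5 ^ 2 = 5 := Real.sq_sqrt (by norm_num)
  have hp : (0 : ℝ) < √5 := by positivity
  have hG : G 0 = 3 + √5 := by rw [G, X₀_zero, P_zero]; ring
  rw [xT, hG, P_zero]
  field_simp
  linear_combination (-2 : ℝ) * h5

theorem differentiable_xT : Differentiable ℝ xT := by
  have h2 := differentiable_P
  have h3 : Differentiable ℝ G := fun x => (hasDerivAt_G x).differentiableAt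
  unfold xT
  exact Differentiable.div (by fun_prop) (by fun_prop)
    fun x => by have := P_pos x; have := G_pos x; positivity

/-- The integrand of `wTilde` is the difference quotient of `xT` at `0`. -/
theorem T_sub_eq_dslope {s : ℝ} (hs : s ≠ 0) : T s - √5 / 2 * (1 / s) = dslope xT 0 s := by
  rw [dslope_of_ne _ hs, slope_def_field, xT_zero, T_eq hs, sub_zero]
  ring

theorem continuous_dslope_xT : Continuous (dslope xT 0) := by
  rw [← continuousOn_univ]
  exact (continuousOn_dslope univ_mem).mpr
    ⟨differentiable_xT.continuous.continuousOn, differentiable_xT 0⟩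

theorem integrand_ae_eq :
    (fun s : ℝ => T s - √5 / 2 * (1 / s)) =ᵐ[MeasureTheory.volume] dslope xT 0 := by
  have : ∀ᵐ s : ℝ, s ≠ 0 := MeasureTheory.Measure.ae_ne MeasureTheory.volume 0
  filter_upwards [this] with s hs using T_sub_eq_dslope hs

theorem intervalIntegrable_integrand (x : ℝ) : IntervalIntegrable
    (fun s : ℝ => T s - √5 / 2 * (1 / s)) MeasureTheory.volume 0 x :=
  (continuous_dslope_xT.intervalIntegrable 0 x).congr_ae
    (MeasureTheory.ae_restrict_of_ae integrand_ae_eq.symm)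

theorem wTilde_eq (x : ℝ) :
    wTilde x = √5 / 2 * Real.log x + ∫ s in (0 : ℝ)..x, dslope xT 0 s := by
  rw [wTilde, intervalIntegral.integral_congr_ae]
  filter_upwards [integrand_ae_eq] with s hs _ using hs

theorem hasDerivAt_wTilde {x : ℝ} (hx : 0 < x) : HasDerivAt wTilde (T x) x := by
  rw [funext wTilde_eq]
  refine (((Real.hasDerivAt_log hx.ne').const_mul (√5 / 2)).add
    (continuous_dslope_xT.integral_hasStrictDerivAt 0 x).hasDerivAt).congr_deriv ?_
  rw [← T_sub_eq_dslope hx.ne']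
  ring

/-- The regular part of `wTilde` vanishes at `0`. -/
theorem tendsto_wTilde_sub_log :
    Tendsto (fun x => wTilde x - √5 / 2 * Real.log x) (𝓝 0) (𝓝 0) := by
  have hfun : (fun x => wTilde x - √5 / 2 * Real.log x)
      = fun x => ∫ s in (0 : ℝ)..x, dslope xT 0 s := by
    funext x; rw [wTilde_eq]; ring
  have hc : Continuous fun x => ∫ s in (0 : ℝ)..x, dslope xT 0 s :=
    continuous_iff_continuousAt.mpr fun x =>
      (continuous_dslope_xT.integral_hasStrictDerivAt 0 x).hasDerivAt.continuousAt
  rw [hfun]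
  simpa using hc.tendsto 0

/-! ### The structure equation in terms of P, G and C. -/

theorem a₁_eq {x : ℝ} (hx : x ≠ 0) (y : ℝ) :
    a₁ x y = y * (G x + x ^ 2 * P x + P x) / (x * (G x + (1 + y ^ 2) * P x)) := by
  rw [a₁, h_eq hx, X₀_add_eq]; ring

theorem b₁_eq {x : ℝ} (hx : x ≠ 0) (y : ℝ) :
    b₁ x y = -((G x + x ^ 2 * P x + P x) / 2 + √5 * (x ^ 2 - y ^ 2))
      / (x * (G x + (1 + y ^ 2) * P x)) := by
  rw [b₁, h_eq hx, X₀_add_eq]; ring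

theorem c₁_eq {x : ℝ} (hx : x ≠ 0) (y : ℝ) :
    c₁ x y = -(G x + x ^ 2 * P x + P x) / (x * (G x + (1 + y ^ 2) * P x)) := by
  rw [c₁, h_eq hx, X₀_add_eq]; ring

theorem a₂_eq {x : ℝ} (hx : x ≠ 0) (y : ℝ) :
    a₂ x y = -(G x + P x - y ^ 2 * P x) / (G x + (1 + y ^ 2) * P x) := by
  have hX : 2 * X₀ x + √5 = G x + x ^ 2 * P x + P x := by rw [G]; ring
  rw [a₂, h_eq hx, hX, dX₀_div hx]; ring

theorem b₂_eq {x : ℝ} (hx : x ≠ 0) (y : ℝ) :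
    b₂ x y = 2 * y * (-(1 / 2) * P x - √5) / (G x + (1 + y ^ 2) * P x) := by
  have : dX₀ x / (2 * x) = P x / 2 := by rw [← dX₀_div hx]; ring
  rw [b₂, h_eq hx, this]; ring

theorem c₂_eq {x : ℝ} (hx : x ≠ 0) (y : ℝ) :
    c₂ x y = 2 * y * C x / (G x + (1 + y ^ 2) * P x) := by
  have hC : ddX₀ x - dX₀ x / x = C x := C₂_eq hx
  rw [c₂, h_eq hx, hC]; ring

variable {φ Xα Xβ ξ : ℝ → ℝ → E4}

/-- Reduces the derivative of a moving combination of the frame to four scalar identities, one for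
each frame vector. -/
theorem IsFrameField.hasDerivAt_comb_x (hF : IsFrameField φ Xα Xβ ξ) {x : ℝ} (hx : 0 < x) (y : ℝ)
    {p q r s : ℝ → ℝ} {p' q' r' s' : ℝ} (hp : HasDerivAt p p' x) (hq : HasDerivAt q q' x)
    (hr : HasDerivAt r r' x) (hs : HasDerivAt s s' x) :
    HasDerivAt (fun t => p t • φ t y + q t • Xα t y + r t • Xβ t y + s t • ξ t y)
      ((p' + q x * a₁ x y) • φ x y
        + (q' - p x * a₁ x y + r x * c₁ x y + s x * b₁ x y) • Xα x y
        + (r' - q x * c₁ x y) • Xβ x y + (s' - q x * b₁ x y) • ξ x y) x := by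
  refine ((((hp.smul (hF.dx_φ x y hx)).add (hq.smul (hF.dx_Xα x y hx))).add
    (hr.smul (hF.dx_Xβ x y hx))).add (hs.smul (hF.dx_ξ x y hx))).congr_deriv ?_
  module

theorem IsFrameField.hasDerivAt_comb_y (hF : IsFrameField φ Xα Xβ ξ) {x : ℝ} (hx : 0 < x) (y : ℝ)
    {p q r s : ℝ → ℝ} {p' q' r' s' : ℝ} (hp : HasDerivAt p p' y) (hq : HasDerivAt q q' y)
    (hr : HasDerivAt r r' y) (hs : HasDerivAt s s' y) :
    HasDerivAt (fun t => p t • φ x t + q t • Xα x t + r t • Xβ x t + s t • ξ x t)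
      ((p' + r y * a₂ x y) • φ x y + (q' - r y * c₂ x y) • Xα x y
        + (r' - p y * a₂ x y + q y * c₂ x y + s y * b₂ x y) • Xβ x y
        + (s' - r y * b₂ x y) • ξ x y) y := by
  refine ((((hp.smul (hF.dy_φ x y hx)).add (hq.smul (hF.dy_Xα x y hx))).add
    (hr.smul (hF.dy_Xβ x y hx))).add (hs.smul (hF.dy_ξ x y hx))).congr_deriv ?_
  module

/-! ### The rotated frame and its derivatives. -/

/-- The vector `(1 + y²)^{-1/2} (y X_β - φ)`. -/
noncomputable def uVec (φ Xβ : ℝ → ℝ → E4) (x y : ℝ) : E4 :=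
  (√(1 + y ^ 2))⁻¹ • (y • Xβ x y - φ x y)

/-- The vector `(1 + y²)^{-1/2} (X_β + y φ)`. -/
noncomputable def eVec (φ Xβ : ℝ → ℝ → E4) (x y : ℝ) : E4 :=
  (√(1 + y ^ 2))⁻¹ • (Xβ x y + y • φ x y)

/-- The vector `ρ⁻¹ (-B₂ X_α + C₂ ξ)`. -/
noncomputable def uTVec (Xα ξ : ℝ → ℝ → E4) (x y : ℝ) : E4 :=
  (ρ x)⁻¹ • (-(B₂ x • Xα x y) + C₂ x • ξ x y)

/-- The unit tangent vector of the curve `u`, up to sign. -/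
noncomputable def wVec (φ Xα Xβ ξ : ℝ → ℝ → E4) (x y : ℝ) : E4 :=
  ((G x - (1 + y ^ 2) * P x) / h x y) • eVec φ Xβ x y
    + (2 * √(1 + y ^ 2) * ρ x / h x y) • fTilde Xα ξ x y

/-- The unit tangent vector of the curve `ũ`. -/
noncomputable def vVec (φ Xα Xβ ξ : ℝ → ℝ → E4) (x y : ℝ) : E4 :=
  (((1 + y ^ 2) * P x - G x) / h x y) • fTilde Xα ξ x y
    + (2 * √(1 + y ^ 2) * ρ x / h x y) • eVec φ Xβ x y

theorem uVec_eq_comb (x y : ℝ) : uVec φ Xβ x y =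
    (-(√(1 + y ^ 2))⁻¹) • φ x y + (0 : ℝ) • Xα x y + (y * (√(1 + y ^ 2))⁻¹) • Xβ x y
      + (0 : ℝ) • ξ x y := by
  rw [uVec]; module

theorem uTVec_eq_comb {x : ℝ} (hx : x ≠ 0) (y : ℝ) : uTVec Xα ξ x y =
    (0 : ℝ) • φ x y + (-((-(1 / 2) * P x - √5) / ρ x)) • Xα x y + (0 : ℝ) • Xβ x y
      + (C x / ρ x) • ξ x y := by
  rw [uTVec, B₂_eq hx, C₂_eq hx, div_eq_mul_inv, div_eq_mul_inv]; module

theorem wVec_eq_comb {x : ℝ} (hx : x ≠ 0) (y : ℝ) : wVec φ Xα Xβ ξ x y =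
    ((G x - (1 + y ^ 2) * P x) * y / ((G x + (1 + y ^ 2) * P x) * √(1 + y ^ 2))) • φ x y
      + (2 * √(1 + y ^ 2) * C x / (G x + (1 + y ^ 2) * P x)) • Xα x y
      + ((G x - (1 + y ^ 2) * P x) / ((G x + (1 + y ^ 2) * P x) * √(1 + y ^ 2))) • Xβ x y
      + (2 * √(1 + y ^ 2) * (-(1 / 2) * P x - √5) / (G x + (1 + y ^ 2) * P x)) • ξ x y := by
  have hρ := (ρ_pos hx).ne'
  simp only [wVec, eVec, fTilde, B₂_eq hx, C₂_eq hx, h_eq hx, smul_add, smul_smul, add_assoc]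
  have e1 : ∀ a b : ℝ, a * ρ x / b * ((ρ x)⁻¹ * C x) = a * C x / b := fun a b => by field_simp
  have e2 : ∀ a b : ℝ, a * ρ x / b * ((ρ x)⁻¹ * (-(1 / 2) * P x - √5))
    = a * (-(1 / 2) * P x - √5) / b := fun a b => by field_simp
  rw [e1, e2]
  simp only [div_eq_mul_inv, mul_inv]
  module

theorem vVec_eq_comb {x : ℝ} (hx : x ≠ 0) (y : ℝ) : vVec φ Xα Xβ ξ x y =
    (2 * y * ρ x / (G x + (1 + y ^ 2) * P x)) • φ x y
      + (((1 + y ^ 2) * P x - G x) * C x / ((G x + (1 + y ^ 2) * P x) * ρ x)) • Xα x y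
      + (2 * ρ x / (G x + (1 + y ^ 2) * P x)) • Xβ x y
      + (((1 + y ^ 2) * P x - G x) * (-(1 / 2) * P x - √5)
          / ((G x + (1 + y ^ 2) * P x) * ρ x)) • ξ x y := by
  have hκ : √(1 + y ^ 2) ≠ 0 := by positivity
  have e : ∀ a b : ℝ, 2 * √(1 + y ^ 2) * a / b * (√(1 + y ^ 2))⁻¹ = 2 * a / b :=
    fun a b => by field_simp
  simp only [vVec, eVec, fTilde, B₂_eq hx, C₂_eq hx, h_eq hx, smul_add, smul_smul, ← mul_assoc, e]
  simp only [div_eq_mul_inv, mul_inv]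
  module

theorem hasDerivAt_ρ {x : ℝ} (hx : 0 < x) :
    HasDerivAt ρ (C x * (G x - P x * (x ^ 2 + 1)) / (2 * x * ρ x)) x := by
  have h1 : (fun s => √(P s * G s)) =ᶠ[𝓝 x] ρ := by
    filter_upwards [lt_mem_nhds hx] with s hs using (ρ_eq hs.ne').symm
  refine HasDerivAt.congr_of_eventuallyEq ?_ h1.symm
  have hpg := mul_pos (P_pos x) (G_pos x)
  refine (((hasDerivAt_P x).mul (hasDerivAt_G x)).sqrt hpg.ne').congr_deriv ?_
  rw [ρ_eq hx.ne']
  simp only [Pi.mul_apply]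
  field_simp
  ring

theorem hasDerivAt_sqrt_one_add_sq (y : ℝ) :
    HasDerivAt (fun t : ℝ => √(1 + t ^ 2)) (y / √(1 + y ^ 2)) y := by
  refine (((hasDerivAt_pow 2 y).const_add 1).sqrt (by positivity)).congr_deriv ?_
  field_simp
  norm_num

theorem G_add_pos (x y : ℝ) : 0 < G x + (1 + y ^ 2) * P x := by
  have := P_pos x
  have := G_pos x
  positivity

/-- Only the X_α component could survive, and it is a multiple of a₁ + y c₁ = 0. -/
theorem IsFrameField.hasDerivAt_uVec_x (hF : IsFrameField φ Xα Xβ ξ) {x : ℝ} (hx : 0 < x) (y : ℝ) :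
    HasDerivAt (fun s => uVec φ Xβ s y) 0 x := by
  simp only [uVec_eq_comb (φ := φ) (Xα := Xα) (Xβ := Xβ) (ξ := ξ)]
  refine (hF.hasDerivAt_comb_x hx y (hasDerivAt_const _ _) (hasDerivAt_const _ _)
    (hasDerivAt_const _ _) (hasDerivAt_const _ _)).congr_deriv ?_
  rw [a₁_eq hx.ne', c₁_eq hx.ne']
  module

theorem IsFrameField.hasDerivAt_uVec_y (hF : IsFrameField φ Xα Xβ ξ) {x : ℝ} (hx : 0 < x) (y : ℝ) :
    HasDerivAt (fun t => uVec φ Xβ x t) (-(y ^ 2 / (1 + y ^ 2)) • wVec φ Xα Xβ ξ x y) y := by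
  simp only [uVec_eq_comb (φ := φ) (Xα := Xα) (Xβ := Xβ) (ξ := ξ), wVec_eq_comb hx.ne']
  have hκ : (0 : ℝ) < √(1 + y ^ 2) := by positivity
  have hκ2 : √(1 + y ^ 2) ^ 2 = 1 + y ^ 2 := Real.sq_sqrt (by positivity)
  have hi := (hasDerivAt_sqrt_one_add_sq y).fun_inv hκ.ne'
  refine (hF.hasDerivAt_comb_y hx y hi.fun_neg (hasDerivAt_const _ _)
    ((hasDerivAt_id' y).fun_mul hi) (hasDerivAt_const _ _)).congr_deriv ?_
  rw [a₂_eq hx.ne', b₂_eq hx.ne', c₂_eq hx.ne']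
  have hh := (G_add_pos x y).ne'
  have hq : (1 + y ^ 2) ≠ 0 := by positivity
  clear hi
  simp only [smul_add, smul_smul]
  generalize √(1 + y ^ 2) = κ at *
  generalize G x = G at *
  generalize P x = P at *
  have hh' : G + P * (1 + y ^ 2) ≠ 0 := by rwa [mul_comm P]
  congr 4
  · field_simp
    grind
  · field_simp
    grind
  · field_simp
    grind
  · field_simp
    grind

theorem IsFrameField.hasDerivAt_wVec_y (hF : IsFrameField φ Xα Xβ ξ) {x : ℝ} (hx : 0 < x) (y : ℝ) :
    HasDerivAt (fun t => wVec φ Xα Xβ ξ x t) ((y ^ 2 / (1 + y ^ 2)) • uVec φ Xβ x y) y := by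
  simp only [uVec_eq_comb (φ := φ) (Xα := Xα) (Xβ := Xβ) (ξ := ξ), wVec_eq_comb hx.ne']
  have hκ : (0 : ℝ) < √(1 + y ^ 2) := by positivity
  have hκ2 : √(1 + y ^ 2) ^ 2 = 1 + y ^ 2 := Real.sq_sqrt (by positivity)
  have hh := (G_add_pos x y).ne'
  have hκ' := hasDerivAt_sqrt_one_add_sq y
  have hQ : HasDerivAt (fun t : ℝ => (1 + t ^ 2) * P x) (2 * y * P x) y :=
    (((hasDerivAt_pow 2 y).const_add 1).mul_const (P x)).congr_deriv (by simp)
  have hN := hQ.const_sub (G x)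
  have hH := hQ.const_add (G x)
  have hHκ := hH.fun_mul hκ'
  refine (hF.hasDerivAt_comb_y hx y
    ((hN.fun_mul (hasDerivAt_id' y)).fun_div hHκ (mul_ne_zero hh hκ.ne'))
    (((hκ'.const_mul 2).mul_const (C x)).fun_div hH hh)
    (hN.fun_div hHκ (mul_ne_zero hh hκ.ne'))
    (((hκ'.const_mul 2).mul_const (-(1 / 2) * P x - √5)).fun_div hH hh)).congr_deriv ?_
  rw [a₂_eq hx.ne', b₂_eq hx.ne', c₂_eq hx.ne']
  have hq : (1 + y ^ 2) ≠ 0 := by positivity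
  have hPG := P_mul_G x
  clear hN hH hHκ hQ hκ'
  simp only [smul_add, smul_smul]
  generalize √(1 + y ^ 2) = κ at *
  generalize G x = G at *
  generalize hB : -(1 / 2) * P x - √5 = B at *
  generalize P x = P at *
  generalize C x = C at *
  -- B₂ and P may be treated as independent from here on: the identities need only PG = B₂² + C².
  clear hB
  have hC : C ^ 2 = P * G - B ^ 2 := by linarith
  have hh' : G + P * (1 + y ^ 2) ≠ 0 := by rwa [mul_comm P]
  congr 4
  · field_simp
    grind
  · field_simp
    grind
  · field_simp
    grind
  · field_simp
    grind

theorem IsFrameField.hasDerivAt_uTVec_x (hF : IsFrameField φ Xα Xβ ξ) {x : ℝ} (hx : 0 < x) (y : ℝ) :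
    HasDerivAt (fun s => uTVec Xα ξ s y) (T x • vVec φ Xα Xβ ξ x y) x := by
  have heq : ∀ᶠ s in 𝓝 x, uTVec Xα ξ s y = (0 : ℝ) • φ s y
      + (-((-(1 / 2) * P s - √5) / ρ s)) • Xα s y + (0 : ℝ) • Xβ s y + (C s / ρ s) • ξ s y := by
    filter_upwards [lt_mem_nhds hx] with s hs using uTVec_eq_comb hs.ne' y
  refine HasDerivAt.congr_of_eventuallyEq ?_ heq
  have hρ := ρ_pos hx.ne'
  have hρ2 := ρ_sq hx.ne'
  have hρ' := hasDerivAt_ρ hx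
  have hB' := ((hasDerivAt_P x).const_mul (-(1 / 2))).sub_const (√5)
  refine (hF.hasDerivAt_comb_x hx y (hasDerivAt_const _ _) (hB'.fun_div hρ' hρ.ne').fun_neg
    (hasDerivAt_const _ _) ((hasDerivAt_C x).fun_div hρ' hρ.ne')).congr_deriv ?_
  rw [vVec_eq_comb hx.ne', a₁_eq hx.ne', b₁_eq hx.ne', c₁_eq hx.ne', T_eq hx.ne', xT]
  have hh := (G_add_pos x y).ne'
  have hP := (P_pos x).ne'
  have hG := (G_pos x).ne'
  have hPG := P_mul_G x
  -- X₀ enters through the derivative of `C`; the definition of `G` eliminates it.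
  have hX : X₀ x = (G x + x ^ 2 * P x + P x - √5) / 2 := by rw [G]; ring
  have h5 : √5 ^ 2 = 5 := Real.sq_sqrt (by norm_num)
  have hx0 := hx.ne'
  clear hρ' hB' heq
  simp only [smul_add, smul_smul, hX]
  generalize ρ x = r at *
  generalize G x = G at *
  generalize P x = P at *
  generalize C x = C at *
  generalize √5 = S at *
  clear hX
  have hh' : G + P * (1 + y ^ 2) ≠ 0 := by rwa [mul_comm P]
  congr 4
  · field_simp
    grind
  · field_simp
    grind
  · field_simp
    grind
  · field_simp
    grind

theorem IsFrameField.hasDerivAt_vVec_x (hF : IsFrameField φ Xα Xβ ξ) {x : ℝ} (hx : 0 < x) (y : ℝ) :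
    HasDerivAt (fun s => vVec φ Xα Xβ ξ s y) (-(T x • uTVec Xα ξ x y)) x := by
  have heq : ∀ᶠ s in 𝓝 x, vVec φ Xα Xβ ξ s y =
      (2 * y * ρ s / (G s + (1 + y ^ 2) * P s)) • φ s y
      + (((1 + y ^ 2) * P s - G s) * C s / ((G s + (1 + y ^ 2) * P s) * ρ s)) • Xα s y
      + (2 * ρ s / (G s + (1 + y ^ 2) * P s)) • Xβ s y
      + (((1 + y ^ 2) * P s - G s) * (-(1 / 2) * P s - √5)
          / ((G s + (1 + y ^ 2) * P s) * ρ s)) • ξ s y := by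
    filter_upwards [lt_mem_nhds hx] with s hs using vVec_eq_comb hs.ne' y
  refine HasDerivAt.congr_of_eventuallyEq ?_ heq
  have hρ := ρ_pos hx.ne'
  have hρ2 := ρ_sq hx.ne'
  have hρ' := hasDerivAt_ρ hx
  have hB' := ((hasDerivAt_P x).const_mul (-(1 / 2))).sub_const (√5)
  have hh := (G_add_pos x y).ne'
  have hP' := (hasDerivAt_P x).const_mul (1 + y ^ 2)
  have hH' := (hasDerivAt_G x).fun_add hP'
  have hN' := hP'.fun_sub (hasDerivAt_G x)
  have hD' := hH'.fun_mul hρ'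
  have hD := mul_ne_zero hh hρ.ne'
  refine (hF.hasDerivAt_comb_x hx y ((hρ'.const_mul (2 * y)).fun_div hH' hh)
    ((hN'.fun_mul (hasDerivAt_C x)).fun_div hD' hD)
    ((hρ'.const_mul 2).fun_div hH' hh)
    ((hN'.fun_mul hB').fun_div hD' hD)).congr_deriv ?_
  rw [uTVec_eq_comb (φ := φ) (Xβ := Xβ) hx.ne', a₁_eq hx.ne', b₁_eq hx.ne', c₁_eq hx.ne',
    T_eq hx.ne', xT]
  have hP := (P_pos x).ne'
  have hG := (G_pos x).ne'
  have hPG := P_mul_G x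
  have hX : X₀ x = (G x + x ^ 2 * P x + P x - √5) / 2 := by rw [G]; ring
  have h5 : √5 ^ 2 = 5 := Real.sq_sqrt (by norm_num)
  have hx0 := hx.ne'
  clear hρ' hB' heq hP' hH' hN' hD' hD hF
  simp only [smul_add, smul_smul, hX, ← neg_smul, neg_add]
  generalize ρ x = r at *
  generalize G x = G at *
  generalize P x = P at *
  generalize C x = C at *
  generalize √5 = S at *
  clear hX
  have hh' : G + P * (1 + y ^ 2) ≠ 0 := by rwa [mul_comm P]
  congr 4
  · field_simp
    grind
  · field_simp
    grind
  · field_simp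
    grind
  · field_simp
    grind

/-! ### Orthonormality of the rotated frames. -/

theorem orthonormal_rotate {p q r s : E4} (ho : Orthonormal ℝ ![p, q, r, s]) {a b : ℝ}
    (hab : a ^ 2 + b ^ 2 = 1) : Orthonormal ℝ ![a • p - b • q, b • p + a • q, r, s] := by
  have hn : ∀ i, ‖![p, q, r, s] i‖ = 1 := ho.norm_eq_one
  have hi : ∀ i j, i ≠ j → inner ℝ (![p, q, r, s] i) (![p, q, r, s] j) = 0 :=
    fun i j hij => ho.inner_eq_zero hij
  have hp : ‖p‖ = 1 := hn 0
  have hq : ‖q‖ = 1 := hn 1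
  have hr : ‖r‖ = 1 := hn 2
  have hs : ‖s‖ = 1 := hn 3
  have hpq : inner ℝ p q = 0 := hi 0 1 (by decide)
  have hpr : inner ℝ p r = 0 := hi 0 2 (by decide)
  have hps : inner ℝ p s = 0 := hi 0 3 (by decide)
  have hqr : inner ℝ q r = 0 := hi 1 2 (by decide)
  have hqs : inner ℝ q s = 0 := hi 1 3 (by decide)
  have hrs : inner ℝ r s = 0 := hi 2 3 (by decide)
  have hqp : inner ℝ q p = 0 := by rw [real_inner_comm, hpq]
  have hrp : inner ℝ r p = 0 := by rw [real_inner_comm, hpr]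
  have hsp : inner ℝ s p = 0 := by rw [real_inner_comm, hps]
  have hrq : inner ℝ r q = 0 := by rw [real_inner_comm, hqr]
  have hsq : inner ℝ s q = 0 := by rw [real_inner_comm, hqs]
  have hsr : inner ℝ s r = 0 := by rw [real_inner_comm, hrs]
  rw [orthonormal_iff_ite]
  clear ho hn hi
  intro i j
  fin_cases i <;> fin_cases j <;>
    simp only [inner_add_left, inner_add_right, inner_sub_left, inner_sub_right, inner_smul_left,
      inner_smul_right, real_inner_self_eq_norm_sq, hp, hq, hr, hs, hpq, hpr, hps, hqr, hqs, hrs,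
      hqp, hrp, hsp, hrq, hsq, hsr, Fin.zero_eta, Fin.mk_one, Fin.reduceFinMk, Fin.isValue,
      Matrix.cons_val, Fin.reduceEq, if_true, if_false, conj_trivial] <;> linarith

theorem orthonormal_reorder {p q r s : E4} (ho : Orthonormal ℝ ![p, q, r, s]) {f : Fin 4 → Fin 4}
    (hf : Function.Injective f) : Orthonormal ℝ ![![p, q, r, s] (f 0), ![p, q, r, s] (f 1),
      ![p, q, r, s] (f 2), ![p, q, r, s] (f 3)] := by
  convert ho.comp f hf using 1
  funext i
  fin_cases i <;> rfl

theorem IsFrameField.orthonormal_uT_fT_u_e (hF : IsFrameField φ Xα Xβ ξ) {x : ℝ} (hx : 0 < x)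
    (y : ℝ) : Orthonormal ℝ
      ![uTVec Xα ξ x y, fTilde Xα ξ x y, uVec φ Xβ x y, eVec φ Xβ x y] := by
  have hκ : √(1 + y ^ 2) ≠ 0 := by positivity
  have hκ2 : √(1 + y ^ 2) ^ 2 = 1 + y ^ 2 := Real.sq_sqrt (by positivity)
  have hρ := (ρ_pos hx.ne').ne'
  have hρ2 : ρ x ^ 2 = B₂ x ^ 2 + C₂ x ^ 2 := Real.sq_sqrt (by positivity)
  -- Each permutation moves the pair to be rotated to the front: (X_β, φ) becomes (u, e), then (ξ,
  -- X_α) becomes (ũ, f̃).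
  have h1 := orthonormal_rotate (a := y / √(1 + y ^ 2)) (b := 1 / √(1 + y ^ 2))
    (orthonormal_reorder (hF.orthonormal x y hx) (f := ![2, 0, 1, 3]) (by decide))
    (by field_simp; linarith)
  have h2 := orthonormal_rotate (a := C₂ x / ρ x) (b := B₂ x / ρ x)
    (orthonormal_reorder h1 (f := ![3, 2, 0, 1]) (by decide)) (by field_simp; linarith)
  convert h2 using 2
  · simp [uTVec, div_eq_inv_mul, smul_smul, smul_add]; abel
  congr 1
  · simp [fTilde, div_eq_inv_mul, smul_smul, smul_add]; abel
  congr 1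
  · simp [uVec, div_eq_inv_mul, smul_smul, smul_sub]
  congr 1
  · simp [eVec, div_eq_inv_mul, smul_smul, smul_add]

theorem sq_two_mul_sqrt_mul_ρ_div_h {x : ℝ} (hx : 0 < x) (y : ℝ) :
    (2 * √(1 + y ^ 2) * ρ x / h x y) ^ 2 = 4 * (1 + y ^ 2) * (P x * G x) / h x y ^ 2 := by
  rw [div_pow, mul_pow, mul_pow, ρ_sq hx.ne', Real.sq_sqrt (by positivity)]; ring

theorem IsFrameField.orthonormal_v_w_uT_u (hF : IsFrameField φ Xα Xβ ξ) {x : ℝ} (hx : 0 < x)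
    (y : ℝ) : Orthonormal ℝ
      ![vVec φ Xα Xβ ξ x y, wVec φ Xα Xβ ξ x y, uTVec Xα ξ x y, uVec φ Xβ x y] := by
  have hh := (h_pos hx.ne' y).ne'
  have h1 := orthonormal_rotate (a := 2 * √(1 + y ^ 2) * ρ x / h x y)
    (b := (G x - (1 + y ^ 2) * P x) / h x y)
    (orthonormal_reorder (hF.orthonormal_uT_fT_u_e hx y) (f := ![3, 1, 0, 2]) (by decide)) (by
      -- With ρ² = PG this is 4QG + (G - Q)² = (G + Q)² for Q = (1 + y²)P.
      rw [sq_two_mul_sqrt_mul_ρ_div_h hx]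
      field_simp
      rw [h_eq hx.ne']
      ring)
  convert h1 using 2
  · simp only [vVec, Matrix.cons_val]
    module
  · rfl

/-! ### Estimates of order 1/y as y → ∞. -/

theorem norm_comb {p q : E4} (hp : ‖p‖ = 1) (hq : ‖q‖ = 1) (hpq : inner ℝ p q = 0) (a b : ℝ) :
    ‖a • p + b • q‖ = √(a ^ 2 + b ^ 2) := by
  rw [← Real.sqrt_sq (norm_nonneg _)]
  congr 1
  rw [norm_add_sq_real, norm_smul, norm_smul, inner_smul_left, inner_smul_right, hp, hq, hpq]
  simp

/-- The sum of squares collapses to 4G/h, and h ≥ P y². It is the squared norm of both f̃ - v and e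
+ w. -/
theorem four_G_div_h_le {x : ℝ} (hx : 0 < x) {y : ℝ} (hy : 0 < y) :
    √((2 * G x / h x y) ^ 2 + (2 * √(1 + y ^ 2) * ρ x / h x y) ^ 2) ≤ 2 * √(G x / P x) / y := by
  have hh := h_pos hx.ne' y
  have hP := P_pos x
  have hG := G_pos x
  rw [sq_two_mul_sqrt_mul_ρ_div_h hx]
  have e1 : (2 * G x / h x y) ^ 2 + 4 * (1 + y ^ 2) * (P x * G x) / h x y ^ 2
      = 4 * G x / h x y := by
    field_simp
    rw [h_eq hx.ne']
    ring
  rw [e1]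
  refine Real.sqrt_le_iff.mpr ⟨by positivity, ?_⟩
  rw [div_pow, mul_pow, Real.sq_sqrt (by positivity), h_eq hx.ne']
  rw [mul_div_assoc, mul_div_assoc, show (2 : ℝ) ^ 2 = 4 by norm_num, div_div]
  gcongr
  nlinarith

theorem IsFrameField.norm_fTilde_sub_vVec_le (hF : IsFrameField φ Xα Xβ ξ) {x : ℝ} (hx : 0 < x)
    {y : ℝ} (hy : 0 < y) :
    ‖fTilde Xα ξ x y - vVec φ Xα Xβ ξ x y‖ ≤ 2 * √(G x / P x) / y := by
  have ho := hF.orthonormal_uT_fT_u_e hx y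
  have hh := (h_pos hx.ne' y).ne'
  have hc : 1 - ((1 + y ^ 2) * P x - G x) / h x y = 2 * G x / h x y := by
    field_simp
    rw [h_eq hx.ne']; ring
  have : fTilde Xα ξ x y - vVec φ Xα Xβ ξ x y = (2 * G x / h x y) • fTilde Xα ξ x y
      + (-(2 * √(1 + y ^ 2) * ρ x / h x y)) • eVec φ Xβ x y := by
    rw [vVec, ← hc]; module
  have hn := norm_comb (ho.norm_eq_one 1) (ho.norm_eq_one 3) (ho.inner_eq_zero (by decide))
    (2 * G x / h x y) (-(2 * √(1 + y ^ 2) * ρ x / h x y))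
  rw [neg_sq] at hn
  rw [this]
  exact hn.trans_le (four_G_div_h_le hx hy)

theorem IsFrameField.norm_eVec_add_wVec_le (hF : IsFrameField φ Xα Xβ ξ) {x : ℝ} (hx : 0 < x)
    {y : ℝ} (hy : 0 < y) :
    ‖eVec φ Xβ x y + wVec φ Xα Xβ ξ x y‖ ≤ 2 * √(G x / P x) / y := by
  have ho := hF.orthonormal_uT_fT_u_e hx y
  have hh := (h_pos hx.ne' y).ne'
  have hc : 1 + (G x - (1 + y ^ 2) * P x) / h x y = 2 * G x / h x y := by
    field_simp
    rw [h_eq hx.ne']; ring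
  have : eVec φ Xβ x y + wVec φ Xα Xβ ξ x y = (2 * G x / h x y) • eVec φ Xβ x y
      + (2 * √(1 + y ^ 2) * ρ x / h x y) • fTilde Xα ξ x y := by
    rw [wVec, ← hc]; module
  have hn := norm_comb (ho.norm_eq_one 3) (ho.norm_eq_one 1) (ho.inner_eq_zero (by decide))
    (2 * G x / h x y) (2 * √(1 + y ^ 2) * ρ x / h x y)
  rw [this]
  exact hn.trans_le (four_G_div_h_le hx hy)

/-! ### Independence of one of the two variables. -/

theorem eq_of_hasDerivAt_zero {g : ℝ → E4} (hg : ∀ y, HasDerivAt g 0 y) (y z : ℝ) : g y = g z :=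
  is_const_of_deriv_eq_zero (fun s => (hg s).differentiableAt) (fun s => (hg s).deriv) y z

theorem eq_of_hasDerivAt_zero_Ioi {g : ℝ → E4} (hg : ∀ x, 0 < x → HasDerivAt g 0 x) {x z : ℝ}
    (hx : 0 < x) (hz : 0 < z) : g x = g z :=
  isOpen_Ioi.is_const_of_deriv_eq_zero isPreconnected_Ioi
    (fun s hs => (hg s hs).differentiableAt.differentiableWithinAt)
    (fun s hs => (hg s hs).deriv) hx hz

theorem IsFrameField.uVec_eq (hF : IsFrameField φ Xα Xβ ξ) {x z : ℝ} (hx : 0 < x) (hz : 0 < z)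
    (y : ℝ) : uVec φ Xβ x y = uVec φ Xβ z y :=
  eq_of_hasDerivAt_zero_Ioi (g := fun s => uVec φ Xβ s y)
    (fun _ hs => hF.hasDerivAt_uVec_x hs y) hx hz

/-- The pair (b₂, c₂) is proportional to (B₂, C₂), so the only possible component of the
y-derivative, along X_β, cancels. -/
theorem IsFrameField.uTVec_eq (hF : IsFrameField φ Xα Xβ ξ) {x : ℝ} (hx : 0 < x) (y z : ℝ) :
    uTVec Xα ξ x y = uTVec Xα ξ x z := by
  refine eq_of_hasDerivAt_zero (g := fun t => uTVec Xα ξ x t) (fun t => ?_) y z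
  simp only [uTVec_eq_comb (φ := φ) (Xβ := Xβ) hx.ne']
  refine (hF.hasDerivAt_comb_y hx t (hasDerivAt_const _ _) (hasDerivAt_const _ _)
    (hasDerivAt_const _ _) (hasDerivAt_const _ _)).congr_deriv ?_
  rw [b₂_eq hx.ne', c₂_eq hx.ne']
  module

theorem IsFrameField.hasDerivAt_fTilde_y (hF : IsFrameField φ Xα Xβ ξ) {x : ℝ} (hx : 0 < x)
    (y : ℝ) : HasDerivAt (fun t => (ρ x)⁻¹ • fTilde Xα ξ x t) ((2 * y / h x y) • Xβ x y) y := by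
  have hρ := (ρ_pos hx.ne').ne'
  have hρ2 : ρ x ^ 2 = B₂ x ^ 2 + C₂ x ^ 2 := Real.sq_sqrt (by positivity)
  have hh := (h_pos hx.ne' y).ne'
  refine ((((hF.dy_Xα x y hx).const_smul (C₂ x)).fun_add
    ((hF.dy_ξ x y hx).const_smul (B₂ x))).const_smul (ρ x)⁻¹).const_smul (ρ x)⁻¹
    |>.congr_deriv ?_
  rw [b₂_eq hx.ne', c₂_eq hx.ne', ← h_eq hx.ne', ← B₂_eq hx.ne', ← C₂_eq hx.ne']
  simp only [smul_smul, ← add_smul]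
  congr 1
  field_simp
  linear_combination (-y) * hρ2

theorem IsCurvatureSurface.isATilde {f : ℝ → ℝ → E4} (hf : IsCurvatureSurface f φ Xα Xβ ξ) :
    IsATilde f Xα ξ (fun x => f x 0 - (ρ x)⁻¹ • fTilde Xα ξ x 0) := by
  intro x y hx
  have := eq_of_hasDerivAt_zero (g := fun t => f x t - (ρ x)⁻¹ • fTilde Xα ξ x t)
    (fun t => ((hf.dy x t hx).sub (hf.frame.hasDerivAt_fTilde_y hx t)).congr_deriv
      (sub_self _)) y 0
  simp only [← this]; abel

/-- No computation is needed: T v is the x-derivative of ũ, which is free of y, and T ≠ 0. -/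
theorem IsFrameField.vVec_eq (hF : IsFrameField φ Xα Xβ ξ) {x : ℝ} (hx : 0 < x) (y z : ℝ) :
    vVec φ Xα Xβ ξ x y = vVec φ Xα Xβ ξ x z := by
  have heq : (fun s => uTVec Xα ξ s y) =ᶠ[𝓝 x] fun s => uTVec Xα ξ s z := by
    filter_upwards [lt_mem_nhds hx] with s hs using hF.uTVec_eq hs y z
  exact smul_right_injective E4 (T_pos hx).ne'
    ((hF.hasDerivAt_uTVec_x hx y).unique ((hF.hasDerivAt_uTVec_x hx z).congr_of_eventuallyEq heq))

/-- The same argument in the other variable; y ≠ 0 is required because the speed y²/(1 + y²)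
vanishes at 0. -/
theorem IsFrameField.wVec_eq (hF : IsFrameField φ Xα Xβ ξ) {x z : ℝ} (hx : 0 < x) (hz : 0 < z)
    {y : ℝ} (hy : y ≠ 0) : wVec φ Xα Xβ ξ x y = wVec φ Xα Xβ ξ z y := by
  have heq : (fun t => uVec φ Xβ x t) = fun t => uVec φ Xβ z t :=
    funext fun t => hF.uVec_eq hx hz t
  have h1 := hF.hasDerivAt_uVec_y hx y
  rw [heq] at h1
  exact smul_right_injective E4 (neg_ne_zero.mpr (by positivity : y ^ 2 / (1 + y ^ 2) ≠ 0))
    (h1.unique (hF.hasDerivAt_uVec_y hz y))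

/-! ### Rotating pairs and locally uniform convergence. -/

/-- Undoing a rotation by an angle whose speed is that of the rotating pair. -/
theorem hasDerivAt_unrotate {p q : ℝ → E4} {θ : ℝ → ℝ} {k t : ℝ}
    (hp : HasDerivAt p (k • q t) t) (hq : HasDerivAt q (-(k • p t)) t) (hθ : HasDerivAt θ k t) :
    HasDerivAt (fun s => Real.cos (θ s) • p s - Real.sin (θ s) • q s) 0 t ∧
      HasDerivAt (fun s => Real.sin (θ s) • p s + Real.cos (θ s) • q s) 0 t := by
  constructor
  · refine ((hθ.cos.fun_smul hp).fun_sub (hθ.sin.fun_smul hq)).congr_deriv ?_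
    module
  · refine ((hθ.sin.fun_smul hp).fun_add (hθ.cos.fun_smul hq)).congr_deriv ?_
    module

theorem rotate_unrotate (p q : E4) (θ : ℝ) :
    p = Real.cos θ • (Real.cos θ • p - Real.sin θ • q)
        + Real.sin θ • (Real.sin θ • p + Real.cos θ • q) ∧
      q = -(Real.sin θ • (Real.cos θ • p - Real.sin θ • q))
        + Real.cos θ • (Real.sin θ • p + Real.cos θ • q) := by
  have h1 := Real.sin_sq_add_cos_sq θ
  constructor
  · calc p = (Real.sin θ ^ 2 + Real.cos θ ^ 2) • p := by rw [h1, one_smul]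
      _ = _ := by module
  · calc q = (Real.sin θ ^ 2 + Real.cos θ ^ 2) • q := by rw [h1, one_smul]
      _ = _ := by module

/-- By continuity K stays below |K x| + 1 near x, so one threshold for y serves a whole
neighbourhood. -/
theorem tendstoLocallyUniformlyOn_of_le_div {F : ℝ → ℝ → E4} {g : ℝ → E4} {K : ℝ → ℝ}
    (hK : ContinuousOn K (Ioi 0)) (hb : ∀ x, 0 < x → ∀ y, 0 < y → ‖F y x - g x‖ ≤ K x / y) :
    TendstoLocallyUniformlyOn F g atTop (Ioi 0) := by
  rw [Metric.tendstoLocallyUniformlyOn_iff]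
  intro ε hε x hx
  have hlt : ∀ᶠ z in 𝓝[Ioi 0] x, K z < |K x| + 1 :=
    (hK x hx).eventually_lt_const (by linarith [le_abs_self (K x)])
  refine ⟨{z | K z < |K x| + 1} ∩ Ioi 0, inter_mem hlt self_mem_nhdsWithin, ?_⟩
  filter_upwards [eventually_gt_atTop 0, eventually_gt_atTop ((|K x| + 1) / ε)] with y hy hy' z hz
  rw [dist_comm, dist_eq_norm]
  refine (hb z hz.2 y hy).trans_lt ?_
  rw [div_lt_iff₀ hε] at hy'
  rw [div_lt_iff₀ hy]
  have : K z < |K x| + 1 := hz.1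
  linarith

/-! ### The limit x → 0. -/

theorem continuous_P : Continuous P := differentiable_P.continuous

theorem continuous_C : Continuous C := differentiable_C.continuous

theorem continuous_G : Continuous G :=
  continuous_iff_continuousAt.mpr fun x => (hasDerivAt_G x).continuousAt

/-- A bound for `‖X_α(x, y) - ũ(x)‖` plus twice the regular part of `wTilde`. -/
noncomputable def limitBound (x : ℝ) : ℝ :=
  |1 + (-(1 / 2) * P x - √5) / √(P x * G x)| + |C x / √(P x * G x)|
    + 2 * |wTilde x - √5 / 2 * Real.log x|

theorem tendsto_limitBound : Tendsto limitBound (𝓝 0) (𝓝 0) := by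
  have hne : ∀ x, √(P x * G x) ≠ 0 := fun x =>
    (Real.sqrt_pos.mpr (mul_pos (P_pos x) (G_pos x))).ne'
  have hP := continuous_P
  have hC := continuous_C
  have hG := continuous_G
  have h0 : √(P 0 * G 0) = 1 + √5 := by
    rw [P_mul_G, P_zero, C_zero, show (-(1 / 2) * 2 - √5) ^ 2 + (0 : ℝ) ^ 2 = (1 + √5) ^ 2 by ring]
    exact Real.sqrt_sq (by positivity)
  have hc : Continuous fun x => |1 + (-(1 / 2) * P x - √5) / √(P x * G x)|
      + |C x / √(P x * G x)| :=
    ((continuous_const.add (Continuous.div (by fun_prop) (by fun_prop) hne)).abs).add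
      ((Continuous.div (by fun_prop) (by fun_prop) hne).abs)
  have h1 := hc.tendsto 0
  have e0 : |1 + (-(1 / 2) * P 0 - √5) / √(P 0 * G 0)| + |C 0 / √(P 0 * G 0)| = 0 := by
    have hp : 1 + √5 ≠ 0 := by positivity
    rw [h0, P_zero, C_zero, show (-(1 / 2) * 2 - √5) = -(1 + √5) by ring, neg_div, div_self hp]
    simp
  simp only [e0] at h1
  have h2 := (tendsto_wTilde_sub_log.abs).const_mul 2
  have h3 := h1.add h2
  rwa [abs_zero, mul_zero, add_zero] at h3

/-- X_α - ũ = (1 + B₂/ρ) X_α - (C₂/ρ) ξ, and the circle of ũ is compared with that of angle (√5/2)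
log x. The bound is free of y, whence the uniformity. -/
theorem IsFrameField.norm_Xα_sub_le (hF : IsFrameField φ Xα Xβ ξ) {b c : E4} (hb : ‖b‖ = 1)
    (hc : ‖c‖ = 1) {x : ℝ} (hx : 0 < x) (y : ℝ)
    (hu : uTVec Xα ξ x y = Real.cos (wTilde x) • b + Real.sin (wTilde x) • c) :
    ‖Xα x y - (Real.cos (√5 / 2 * Real.log x) • b + Real.sin (√5 / 2 * Real.log x) • c)‖
      ≤ limitBound x := by
  have hXα : ‖Xα x y‖ = 1 := (hF.orthonormal x y hx).norm_eq_one 1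
  have hξ : ‖ξ x y‖ = 1 := (hF.orthonormal x y hx).norm_eq_one 3
  have e : Xα x y - (Real.cos (√5 / 2 * Real.log x) • b + Real.sin (√5 / 2 * Real.log x) • c)
      = ((1 + (-(1 / 2) * P x - √5) / ρ x) • Xα x y - (C x / ρ x) • ξ x y)
        + ((Real.cos (wTilde x) - Real.cos (√5 / 2 * Real.log x)) • b
          + (Real.sin (wTilde x) - Real.sin (√5 / 2 * Real.log x)) • c) := by
    have e1 : Xα x y = (1 + (-(1 / 2) * P x - √5) / ρ x) • Xα x y - (C x / ρ x) • ξ x y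
        + uTVec Xα ξ x y := by
      rw [uTVec, B₂_eq hx.ne', C₂_eq hx.ne', div_eq_mul_inv, div_eq_mul_inv]; module
    nth_rewrite 1 [e1]
    rw [hu]; module
  rw [e, ρ_eq hx.ne', limitBound]
  have t1 := norm_sub_le ((1 + (-(1 / 2) * P x - √5) / √(P x * G x)) • Xα x y)
    ((C x / √(P x * G x)) • ξ x y)
  have t2 := norm_add_le ((Real.cos (wTilde x) - Real.cos (√5 / 2 * Real.log x)) • b)
    ((Real.sin (wTilde x) - Real.sin (√5 / 2 * Real.log x)) • c)
  rw [norm_smul, norm_smul, hXα, hξ, mul_one, mul_one, Real.norm_eq_abs, Real.norm_eq_abs] at t1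
  rw [norm_smul, norm_smul, hb, hc, mul_one, mul_one, Real.norm_eq_abs, Real.norm_eq_abs] at t2
  have t3 := Real.abs_cos_sub_cos_le (wTilde x) (√5 / 2 * Real.log x)
  have t4 := Real.abs_sin_sub_sin_le (wTilde x) (√5 / 2 * Real.log x)
  refine (norm_add_le _ _).trans ?_
  linarith

/-! ### The angle y - arctan y and the limits of X_β and φ. -/

theorem hasDerivAt_sub_arctan (y : ℝ) :
    HasDerivAt (fun t => t - Real.arctan t) (y ^ 2 / (1 + y ^ 2)) y := by
  refine ((hasDerivAt_id' y).fun_sub (Real.hasDerivAt_arctan y)).congr_deriv ?_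
  field_simp
  ring

theorem cos_mul_cos_sub_arctan (y : ℝ) :
    Real.cos y * Real.cos (y - Real.arctan y) + Real.sin y * Real.sin (y - Real.arctan y)
      = (√(1 + y ^ 2))⁻¹ := by
  rw [← Real.cos_sub, sub_sub_cancel, Real.cos_arctan, one_div]

theorem sin_mul_cos_sub_arctan (y : ℝ) :
    Real.sin y * Real.cos (y - Real.arctan y) - Real.cos y * Real.sin (y - Real.arctan y)
      = (√(1 + y ^ 2))⁻¹ * y := by
  rw [← Real.sin_sub, sub_sub_cancel, Real.sin_arctan, div_eq_inv_mul]

/-- Undoing the angle y - arctan y and then turning by y leaves the angle arctan y, with cosine (1 +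
y²)^{-1/2} and sine y(1 + y²)^{-1/2}. -/
theorem cos_add_sin_unrotate (p q : E4) (y : ℝ) :
    Real.cos y • (Real.cos (y - Real.arctan y) • p - Real.sin (y - Real.arctan y) • q)
      + Real.sin y • (Real.sin (y - Real.arctan y) • p + Real.cos (y - Real.arctan y) • q)
      = (√(1 + y ^ 2))⁻¹ • (p + y • q) := by
  calc _ = (Real.cos y * Real.cos (y - Real.arctan y)
          + Real.sin y * Real.sin (y - Real.arctan y)) • p
        + (Real.sin y * Real.cos (y - Real.arctan y)
          - Real.cos y * Real.sin (y - Real.arctan y)) • q := by module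
    _ = _ := by rw [cos_mul_cos_sub_arctan, sin_mul_cos_sub_arctan]; module

theorem sin_add_cos_unrotate (p q : E4) (y : ℝ) :
    -(Real.sin y • (Real.cos (y - Real.arctan y) • p - Real.sin (y - Real.arctan y) • q))
      + Real.cos y • (Real.sin (y - Real.arctan y) • p + Real.cos (y - Real.arctan y) • q)
      = (√(1 + y ^ 2))⁻¹ • (q - y • p) := by
  calc _ = (Real.cos y * Real.cos (y - Real.arctan y)
          + Real.sin y * Real.sin (y - Real.arctan y)) • q
        - (Real.sin y * Real.cos (y - Real.arctan y)
          - Real.cos y * Real.sin (y - Real.arctan y)) • p := by module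
    _ = _ := by rw [cos_mul_cos_sub_arctan, sin_mul_cos_sub_arctan]; module

theorem inv_sqrt_smul_sq_smul (y : ℝ) (z : E4) :
    (√(1 + y ^ 2))⁻¹ • ((√(1 + y ^ 2))⁻¹ • ((1 + y ^ 2) • z)) = z := by
  have h1 : √(1 + y ^ 2) ^ 2 = 1 + y ^ 2 := Real.sq_sqrt (by positivity)
  have h2 : √(1 + y ^ 2) ≠ 0 := by positivity
  have h3 : (√(1 + y ^ 2))⁻¹ * (√(1 + y ^ 2))⁻¹ * (1 + y ^ 2) = 1 := by
    nth_rewrite 3 [← h1]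
    field_simp
  rw [smul_smul, smul_smul, h3, one_smul]

theorem Xβ_eq (x y : ℝ) :
    Xβ x y = (√(1 + y ^ 2))⁻¹ • (eVec φ Xβ x y + y • uVec φ Xβ x y) := by
  nth_rewrite 1 [← inv_sqrt_smul_sq_smul y (Xβ x y)]
  rw [eVec, uVec]; module

theorem φ_eq (x y : ℝ) :
    φ x y = (√(1 + y ^ 2))⁻¹ • (y • eVec φ Xβ x y - uVec φ Xβ x y) := by
  nth_rewrite 1 [← inv_sqrt_smul_sq_smul y (φ x y)]
  rw [eVec, uVec]; module

theorem inv_sqrt_le {y : ℝ} (hy : 0 < y) : (√(1 + y ^ 2))⁻¹ ≤ 1 / y := by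
  rw [one_div]
  gcongr
  exact Real.le_sqrt_of_sq_le (by linarith)

theorem IsFrameField.norm_Xβ_sub_le (hF : IsFrameField φ Xα Xβ ξ) {x : ℝ} (hx : 0 < x) {y : ℝ}
    (hy : 0 < y) :
    ‖Xβ x y - (√(1 + y ^ 2))⁻¹ • (wVec φ Xα Xβ ξ x y + y • uVec φ Xβ x y)‖ ≤ 2 / y := by
  have he : ‖eVec φ Xβ x y‖ = 1 := (hF.orthonormal_uT_fT_u_e hx y).norm_eq_one 3
  have hw : ‖wVec φ Xα Xβ ξ x y‖ = 1 := (hF.orthonormal_v_w_uT_u hx y).norm_eq_one 1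
  rw [Xβ_eq (φ := φ) (Xβ := Xβ) x y, ← smul_sub, add_sub_add_right_eq_sub, norm_smul,
    Real.norm_of_nonneg (by positivity)]
  have := norm_sub_le (eVec φ Xβ x y) (wVec φ Xα Xβ ξ x y)
  calc _ ≤ 1 / y * 2 := by
        gcongr
        · exact inv_sqrt_le hy
        · linarith
    _ = _ := by ring

/-- Here e + w carries a factor y, so its decay of order 1/y is essential; for X_β the crude bound
‖e - w‖ ≤ 2 is enough. -/
theorem IsFrameField.norm_φ_sub_le (hF : IsFrameField φ Xα Xβ ξ) {x : ℝ} (hx : 0 < x) {y : ℝ}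
    (hy : 0 < y) :
    ‖φ x y - (√(1 + y ^ 2))⁻¹ • (uVec φ Xβ x y - y • wVec φ Xα Xβ ξ x y)‖
      ≤ (2 * √(G x / P x) + 2) / y := by
  have hu : ‖uVec φ Xβ x y‖ = 1 := (hF.orthonormal_uT_fT_u_e hx y).norm_eq_one 2
  have hew := hF.norm_eVec_add_wVec_le hx hy
  have e : φ x y - (√(1 + y ^ 2))⁻¹ • (uVec φ Xβ x y - y • wVec φ Xα Xβ ξ x y)
      = (√(1 + y ^ 2))⁻¹ • (y • (eVec φ Xβ x y + wVec φ Xα Xβ ξ x y)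
        - (2 : ℝ) • uVec φ Xβ x y) := by
    nth_rewrite 1 [φ_eq (φ := φ) (Xβ := Xβ) x y]
    module
  rw [e, norm_smul, Real.norm_of_nonneg (by positivity)]
  have h1 : ‖y • (eVec φ Xβ x y + wVec φ Xα Xβ ξ x y) - (2 : ℝ) • uVec φ Xβ x y‖
      ≤ 2 * √(G x / P x) + 2 := by
    refine (norm_sub_le _ _).trans ?_
    rw [norm_smul, norm_smul, hu, Real.norm_of_nonneg hy.le]
    rw [le_div_iff₀ hy] at hew
    norm_num
    linarith
  calc _ ≤ 1 / y * (2 * √(G x / P x) + 2) := by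
        gcongr
        exact inv_sqrt_le hy
    _ = _ := by ring

theorem continuous_sqrt_G_div_P : Continuous fun x => 2 * √(G x / P x) :=
  continuous_const.mul (continuous_G.div continuous_P fun x => (P_pos x).ne').sqrt

theorem continuousOn_inv_ρ : ContinuousOn (fun x => (ρ x)⁻¹) (Ioi 0) := fun _ hx =>
  ((hasDerivAt_ρ hx).continuousAt.inv₀ (ρ_pos (ne_of_gt hx)).ne').continuousWithinAt

/-! ### Construction of the basis and assembly. -/

theorem IsCurvatureSurface.exists_limitFrame {f : ℝ → ℝ → E4}
    (hf : IsCurvatureSurface f φ Xα Xβ ξ) :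
    ∃ (u uT A : ℝ → E4) (b c bT cT : E4),
      IsU φ Xβ u ∧ IsUTilde Xα ξ uT ∧ IsATilde f Xα ξ A ∧ IsLimitFrame Xα u b c bT cT ∧
      ∃ v : ℝ → E4,
        (∀ x : ℝ, 0 < x → ‖v x‖ = 1 ∧ HasDerivAt uT (T x • v x) x ∧
          HasDerivAt v (-(T x • uT x)) x ∧
          uT x = Real.cos (wTilde x) • b + Real.sin (wTilde x) • c ∧
          v x = -(Real.sin (wTilde x) • b) + Real.cos (wTilde x) • c) ∧
        TendstoLocallyUniformlyOn (fun (y x : ℝ) => f x y)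
          (fun x : ℝ => (ρ x)⁻¹ • v x + A x) atTop (Ioi 0) ∧
        TendstoLocallyUniformlyOn
          (fun (y x : ℝ) => Xβ x y - (Real.cos y • bT + Real.sin y • cT))
          (fun _ : ℝ => 0) atTop (Ioi 0) ∧
        TendstoLocallyUniformlyOn
          (fun (y x : ℝ) => φ x y - (-(Real.sin y • bT) + Real.cos y • cT))
          (fun _ : ℝ => 0) atTop (Ioi 0) := by
  have hF := hf.frame
  set u : ℝ → E4 := fun y => uVec φ Xβ 1 y with hu
  set w : ℝ → E4 := fun y => wVec φ Xα Xβ ξ 1 y with hw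
  set uT : ℝ → E4 := fun x => uTVec Xα ξ x 0 with huT
  set v : ℝ → E4 := fun x => vVec φ Xα Xβ ξ x 0 with hv
  set τ : ℝ → ℝ := fun y => y - Real.arctan y with hτ
  -- The unrotated pair is constant on (0, ∞), so its value at x = 1 defines the vectors. For the
  -- other plane y = 0 is used, where the angle vanishes and the pair is (w 0, u 0).
  set b : E4 := Real.cos (wTilde 1) • uT 1 - Real.sin (wTilde 1) • v 1 with hb
  set c : E4 := Real.sin (wTilde 1) • uT 1 + Real.cos (wTilde 1) • v 1 with hc
  have hA := hf.isATilde
  have hbx : ∀ x, 0 < x → Real.cos (wTilde x) • uT x - Real.sin (wTilde x) • v x = b :=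
    fun x hx => eq_of_hasDerivAt_zero_Ioi
      (g := fun x => Real.cos (wTilde x) • uT x - Real.sin (wTilde x) • v x)
      (fun s hs => (hasDerivAt_unrotate (hF.hasDerivAt_uTVec_x hs 0) (hF.hasDerivAt_vVec_x hs 0)
        (hasDerivAt_wTilde hs)).1) hx one_pos
  have hcx : ∀ x, 0 < x → Real.sin (wTilde x) • uT x + Real.cos (wTilde x) • v x = c :=
    fun x hx => eq_of_hasDerivAt_zero_Ioi
      (g := fun x => Real.sin (wTilde x) • uT x + Real.cos (wTilde x) • v x)
      (fun s hs => (hasDerivAt_unrotate (hF.hasDerivAt_uTVec_x hs 0) (hF.hasDerivAt_vVec_x hs 0)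
        (hasDerivAt_wTilde hs)).2) hx one_pos
  have hu' : ∀ y, HasDerivAt u (-((y ^ 2 / (1 + y ^ 2)) • w y)) y := fun y =>
    (hF.hasDerivAt_uVec_y one_pos y).congr_deriv (neg_smul _ _)
  have hw' : ∀ y, HasDerivAt w ((y ^ 2 / (1 + y ^ 2)) • u y) y := fun y =>
    hF.hasDerivAt_wVec_y one_pos y
  have hτ0 : τ 0 = 0 := by simp [hτ]
  have hbT : ∀ y, Real.cos (τ y) • w y - Real.sin (τ y) • u y = w 0 := fun y => by
    rw [eq_of_hasDerivAt_zero (g := fun y => Real.cos (τ y) • w y - Real.sin (τ y) • u y)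
      (fun t => (hasDerivAt_unrotate (hw' t) (hu' t) (hasDerivAt_sub_arctan t)).1) y 0]
    simp [hτ0]
  have hcT : ∀ y, Real.sin (τ y) • w y + Real.cos (τ y) • u y = u 0 := fun y => by
    rw [eq_of_hasDerivAt_zero (g := fun y => Real.sin (τ y) • w y + Real.cos (τ y) • u y)
      (fun t => (hasDerivAt_unrotate (hw' t) (hu' t) (hasDerivAt_sub_arctan t)).2) y 0]
    simp [hτ0]
  have ho : Orthonormal ℝ ![b, c, w 0, u 0] :=
    orthonormal_rotate (orthonormal_reorder (hF.orthonormal_v_w_uT_u one_pos 0)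
      (f := ![2, 0, 1, 3]) (by decide)) (Real.cos_sq_add_sin_sq (wTilde 1))
  have huTx : ∀ x, 0 < x → uT x = Real.cos (wTilde x) • b + Real.sin (wTilde x) • c :=
    fun x hx => by
      rw [← hbx x hx, ← hcx x hx]; exact (rotate_unrotate (uT x) (v x) (wTilde x)).1
  have hvx : ∀ x, 0 < x → v x = -(Real.sin (wTilde x) • b) + Real.cos (wTilde x) • c :=
    fun x hx => by
      rw [← hbx x hx, ← hcx x hx]; exact (rotate_unrotate (uT x) (v x) (wTilde x)).2
  refine ⟨u, uT, _, b, c, w 0, u 0, ?_, ?_, hA, ⟨ho, ?_, ?_⟩, v, ?_, ?_, ?_, ?_⟩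
  · intro x y hx
    exact hF.uVec_eq one_pos hx y
  · intro x y hx
    exact hF.uTVec_eq hx 0 y
  · intro ε hε
    have hlim : Tendsto (fun s : ℝ => limitBound (Real.exp (-s))) atTop (𝓝 0) :=
      tendsto_limitBound.comp (Real.tendsto_exp_atBot.comp tendsto_neg_atTop_atBot)
    obtain ⟨S, hS⟩ := eventually_atTop.mp (hlim.eventually_lt_const hε)
    refine ⟨S, fun s hs y => lt_of_le_of_lt ?_ (hS s hs.le)⟩
    have hx := Real.exp_pos (-s)
    have hle := hF.norm_Xα_sub_le (ho.norm_eq_one 0) (ho.norm_eq_one 1) hx y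
      ((hF.uTVec_eq hx y 0).trans (huTx _ hx))
    -- At x = e^{-s} the angle is negative, which produces the minus sign before the sine in
    -- `IsLimitFrame`.
    have harg : √5 / 2 * Real.log (Real.exp (-s)) = -(√5 * s / 2) := by
      rw [Real.log_exp]; ring
    rw [harg, Real.cos_neg, Real.sin_neg, neg_smul, ← sub_eq_add_neg] at hle
    exact hle
  · intro y
    have := (rotate_unrotate (w y) (u y) (τ y)).2
    rwa [hbT y, hcT y] at this
  · intro x hx
    exact ⟨(hF.orthonormal_v_w_uT_u hx 0).norm_eq_one 0, hF.hasDerivAt_uTVec_x hx 0,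
      hF.hasDerivAt_vVec_x hx 0, huTx x hx, hvx x hx⟩
  · refine tendstoLocallyUniformlyOn_of_le_div
      (K := fun x => (ρ x)⁻¹ * (2 * √(G x / P x)))
      (continuousOn_inv_ρ.mul continuous_sqrt_G_div_P.continuousOn) fun x hx y hy => ?_
    rw [hA x y hx, add_sub_add_right_eq_sub, ← smul_sub, norm_smul,
      Real.norm_of_nonneg (inv_nonneg.mpr (ρ_pos hx.ne').le), mul_div_assoc]
    have hle := hF.norm_fTilde_sub_vVec_le hx hy
    rw [hF.vVec_eq hx y 0] at hle
    exact mul_le_mul_of_nonneg_left hle (inv_nonneg.mpr (ρ_pos hx.ne').le)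
  · refine tendstoLocallyUniformlyOn_of_le_div (K := fun _ => 2) continuousOn_const
      fun x hx y hy => ?_
    rw [sub_zero, ← hbT y, ← hcT y, cos_add_sin_unrotate]
    simp only [hw, hu]
    rw [hF.wVec_eq one_pos hx hy.ne', hF.uVec_eq one_pos hx y]
    exact hF.norm_Xβ_sub_le hx hy
  · refine tendstoLocallyUniformlyOn_of_le_div (K := fun x => 2 * √(G x / P x) + 2)
      (continuous_sqrt_G_div_P.add continuous_const).continuousOn fun x hx y hy => ?_
    rw [sub_zero, ← hbT y, ← hcT y, sin_add_cos_unrotate]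
    simp only [hw, hu]
    rw [hF.wVec_eq one_pos hx hy.ne', hF.uVec_eq one_pos hx y]
    exact hF.norm_φ_sub_le hx hy

end CurvatureSurface

theorem mainTheorem8
    (f φ Xα Xβ ξ : ℝ → ℝ → CurvatureSurface.E4)
    (hf : CurvatureSurface.IsCurvatureSurface f φ Xα Xβ ξ) :
    (∀ x : ℝ, 0 < x → IntervalIntegrable
      (fun s : ℝ => CurvatureSurface.T s - √5 / 2 * (1 / s)) MeasureTheory.volume 0 x) ∧
    ∃ (u uT A : ℝ → CurvatureSurface.E4) (b c bT cT : CurvatureSurface.E4),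
      CurvatureSurface.IsU φ Xβ u ∧
      CurvatureSurface.IsUTilde Xα ξ uT ∧
      CurvatureSurface.IsATilde f Xα ξ A ∧
      CurvatureSurface.IsLimitFrame Xα u b c bT cT ∧
      ∃ v : ℝ → CurvatureSurface.E4,
        (∀ x : ℝ, 0 < x →
          ‖v x‖ = 1 ∧
          HasDerivAt uT (CurvatureSurface.T x • v x) x ∧
          HasDerivAt v (-(CurvatureSurface.T x • uT x)) x ∧
          uT x = Real.cos (CurvatureSurface.wTilde x) • b
            + Real.sin (CurvatureSurface.wTilde x) • c ∧
          v x = -(Real.sin (CurvatureSurface.wTilde x) • b)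
            + Real.cos (CurvatureSurface.wTilde x) • c) ∧
        TendstoLocallyUniformlyOn (fun (y x : ℝ) => f x y)
          (fun x : ℝ => (CurvatureSurface.ρ x)⁻¹ • v x + A x) atTop (Ioi 0) ∧
        TendstoLocallyUniformlyOn
          (fun (y x : ℝ) => Xβ x y - (Real.cos y • bT + Real.sin y • cT))
          (fun _ : ℝ => 0) atTop (Ioi 0) ∧
        TendstoLocallyUniformlyOn
          (fun (y x : ℝ) => φ x y - (-(Real.sin y • bT) + Real.cos y • cT))
          (fun _ : ℝ => 0) atTop (Ioi 0) :=
  ⟨fun x _ => CurvatureSurface.intervalIntegrable_integrand x, hf.exists_limitFrame⟩
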